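/- Let $f:\mathbb R_+\to\mathbb C$, $\mathbb R_+=[0,\infty)$, be locally integrable with $f(t)/(1+t)^k$ integrable on $\mathbb R_+$ for some $k\in\mathbb N$. Call a function $F_c$ (respectively $F_s$) on $\mathbb R_+$, subject to the same growth condition, the cosine (respectively sine) Fourier transform of $f$, $$F_c(x)=\int_0^\infty f(t)\cos xt\,dt,\qquad F_s(x)=\int_0^\infty f(t)\sin xt\,dt,$$ if this holds in the sense of tempered distributions, that is, if $\int_0^\infty f(t)\int_0^\infty\varphi(x)\cos tx\,dx\,dt=\int_0^\infty F_c(x)\varphi(x)\,dx$ for all even Schwartz functions $\varphi:\mathbb R\to\mathbb C$ (respectively $\int_0^\infty f(t)\int_0^\infty\varphi(x)\sin tx\,dx\,dt=\int_0^\infty F_s(x)\varphi(x)\,dx$ for all odd Schwartz functions $\varphi$); for $f\in L^1(\mathbb R_+)$ these are the ordinary integrals. Extend $F_c$ to $\mathbb R$ as an even function and $F_s$ as an odd function. For $g\in L^1(\mathbb R)$ let $$\mathcal Hg(x)=\frac1\pi\lim_{\delta\to0+}\int_{|t-x|>\delta}\frac{g(t)}{x-t}\,dt .$$ (1) Suppose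 that the cosine transform $F_c$ of $f$ is integrable on $\mathbb R_+$. Then for almost every $x\in\mathbb R$ the principal value $\mathcal HF_c(x)$ and the $(C,1)$ limit $$F_s(x)=\lim_{N\to\infty}\int_0^N\Bigl(1-\frac tN\Bigr)f(t)\sin xt\,dt$$ (the sine re-expansion of $f$) exist, and $F_s(x)=\mathcal HF_c(x)$. Moreover $F_s$ is integrable on $\mathbb R_+$ if and only if $\mathcal HF_c$ is integrable on $\mathbb R$. (2) Suppose that the sine transform $F_s$ of $f$ is integrable on $\mathbb R_+$. Then for almost every $x\in\mathbb R$ the principal value $\mathcal HF_s(x)$ and the $(C,1)$ limit $$F_c(x)=\lim_{N\to\infty}\int_0^N\Bigl(1-\frac tN\Bigr)f(t)\cos xt\,dt$$ (the cosine re-expansion of $f$) exist, and $F_c(x)=-\mathcal HF_s(x)$. Moreover $F_c$ is integrable on $\mathbb R_+$ if and only if $\mathcal HF_s$ is integrable on $\mathbb R$. -/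

import Mathlib

open MeasureTheory Filter Topology Set
open scoped SchwartzMap

noncomputable section

/-- `f` is a locally integrable function on `[0, ∞)` of tempered growth:
`f(t) / (1 + t)^k` is integrable on `(0, ∞)` for some `k`. -/
def TemperedOnHalfLine (f : ℝ → ℂ) : Prop :=
  ∃ k : ℕ, IntegrableOn (fun t : ℝ => f t / (((1 + t) ^ k : ℝ) : ℂ)) (Ioi 0)

/-- The classical cosine transform `∫₀^∞ φ(x) cos(tx) dx` (used for test functions). -/
def testCos (φ : ℝ → ℂ) (t : ℝ) : ℂ :=
  ∫ x in Ioi (0 : ℝ), φ x * (Real.cos (t * x) : ℂ)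

/-- The classical sine transform `∫₀^∞ φ(x) sin(tx) dx` (used for test functions). -/
def testSin (φ : ℝ → ℂ) (t : ℝ) : ℂ :=
  ∫ x in Ioi (0 : ℝ), φ x * (Real.sin (t * x) : ℂ)

/-- `g` is the cosine Fourier transform on `[0, ∞)` of `f`, normalized as
`g(x) = ∫₀^∞ f(t) cos(xt) dt`, in the sense of tempered distributions: the transform is moved
onto even Schwartz functions. If `f` is integrable on `(0, ∞)` this is the usual integral
(almost everywhere), by Fubini. -/
def IsCosineTransform (f g : ℝ → ℂ) : Prop :=
  TemperedOnHalfLine f ∧ TemperedOnHalfLine g ∧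
    ∀ φ : 𝓢(ℝ, ℂ), (∀ x, φ (-x) = φ x) →
      ∫ t in Ioi (0 : ℝ), f t * testCos φ t = ∫ x in Ioi (0 : ℝ), g x * φ x

/-- `g` is the sine Fourier transform on `[0, ∞)` of `f`, normalized as
`g(x) = ∫₀^∞ f(t) sin(xt) dt`, in the sense of tempered distributions: the transform is moved
onto odd Schwartz functions. -/
def IsSineTransform (f g : ℝ → ℂ) : Prop :=
  TemperedOnHalfLine f ∧ TemperedOnHalfLine g ∧
    ∀ φ : 𝓢(ℝ, ℂ), (∀ x, φ (-x) = -φ x) →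
      ∫ t in Ioi (0 : ℝ), f t * testSin φ t = ∫ x in Ioi (0 : ℝ), g x * φ x

/-- The `(C,1)` means `∫₀^N (1 - t/N) f(t) sin(xt) dt`. -/
def sineMean (f : ℝ → ℂ) (x N : ℝ) : ℂ :=
  ∫ t in (0 : ℝ)..N, ((1 - t / N : ℝ) : ℂ) * f t * (Real.sin (x * t) : ℂ)

/-- The `(C,1)` means `∫₀^N (1 - t/N) f(t) cos(xt) dt`. -/
def cosineMean (f : ℝ → ℂ) (x N : ℝ) : ℂ :=
  ∫ t in (0 : ℝ)..N, ((1 - t / N : ℝ) : ℂ) * f t * (Real.cos (x * t) : ℂ)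

/-- The re-expansion `∫₀^∞ f(t) sin(xt) dt` as a `(C,1)` limit (where the limit exists). -/
def sineReexpansion (f : ℝ → ℂ) (x : ℝ) : ℂ := limUnder atTop (sineMean f x)

/-- The re-expansion `∫₀^∞ f(t) cos(xt) dt` as a `(C,1)` limit (where the limit exists). -/
def cosineReexpansion (f : ℝ → ℂ) (x : ℝ) : ℂ := limUnder atTop (cosineMean f x)

/-- The truncated Hilbert transform `(1/π) ∫_{|t - x| > δ} g(t) / (x - t) dt`. -/
def truncHilbert (g : ℝ → ℂ) (x δ : ℝ) : ℂ :=
  ((1 / Real.pi : ℝ) : ℂ) * ∫ t in {t : ℝ | δ < |t - x|}, g t / ((x - t : ℝ) : ℂ)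

/-- The Hilbert transform as a principal value (where it exists). -/
def hilbertTransform (g : ℝ → ℂ) (x : ℝ) : ℂ := limUnder (𝓝[>] 0) (truncHilbert g x)

/-- Even extension to `ℝ` of a function on `[0, ∞)`. -/
def evenExt (g : ℝ → ℂ) (x : ℝ) : ℂ := g |x|

/-- Odd extension to `ℝ` of a function on `(0, ∞)`. -/
def oddExt (g : ℝ → ℂ) (x : ℝ) : ℂ := (Real.sign x : ℂ) * g |x|

end

/-!
For an integrable `f ≥ 0` on the line, the Cauchy integral `C f` maps the upper half-plane to the
lower one, so `exp (-i C f)` is bounded and Fatou's theorem provides its vertical limits almost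
everywhere. Its modulus is the exponential of a Poisson integral, so the limits are nonzero and
`C f` itself converges; by linearity this extends to every integrable `f`. The real part of the
Cauchy kernel is the conjugate Poisson kernel. This kernel, the truncated Hilbert kernel and the
conjugate Fejér kernel are odd, and they differ by functions dominated by the Poisson kernel;
hence the three means have the same limit at each Lebesgue point of `f`.

Fourier inversion, applied to test functions, shows that `f` is almost everywhere `2 / π` times the
transform of its integrable transform. Its `(C,1)` means against the conjugate trigonometric kernel
are therefore conjugate Fejér means of the extended transform.
-/

noncomputable section

open Metric
open scoped ENNReal

section PoissonKernel

/-- The Poisson kernel of the upper half plane at height `y`, without the customary factor `1 / π`: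
its integral over `ℝ` is `π`. -/
def halfPlanePoisson (y u : ℝ) : ℝ := y / (u ^ 2 + y ^ 2)

/-- The conjugate Poisson kernel of the upper half plane at height `y`, with the normalization of
`halfPlanePoisson`. -/
def halfPlaneConjPoisson (y u : ℝ) : ℝ := u / (u ^ 2 + y ^ 2)

variable {y : ℝ}

theorem measurable_halfPlanePoisson (y : ℝ) : Measurable (halfPlanePoisson y) := by
  unfold halfPlanePoisson
  fun_prop

theorem measurable_halfPlaneConjPoisson (y : ℝ) : Measurable (halfPlaneConjPoisson y) := by
  unfold halfPlaneConjPoisson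
  fun_prop

theorem odd_halfPlaneConjPoisson (y : ℝ) : Function.Odd (halfPlaneConjPoisson y) := fun u => by
  simp only [halfPlaneConjPoisson, neg_sq, neg_div]

theorem integral_eq_zero_of_odd {E : Type*} [NormedAddCommGroup E] [NormedSpace ℝ E] {f : ℝ → E}
    (hf : Function.Odd f) : ∫ u, f u = 0 := by
  have h := integral_neg_eq_self f volume
  simp only [hf _, integral_neg] at h
  have htwice : (2 : ℝ) • ∫ u, f u = 0 := by
    rw [two_smul]
    exact neg_eq_iff_add_eq_zero.1 h
  exact (smul_eq_zero_iff_right two_ne_zero).1 htwice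

theorem halfPlanePoisson_pos (hy : 0 < y) (u : ℝ) : 0 < halfPlanePoisson y u := by
  unfold halfPlanePoisson
  positivity

theorem halfPlanePoisson_le_inv (hy : 0 < y) (u : ℝ) : halfPlanePoisson y u ≤ y⁻¹ := by
  rw [halfPlanePoisson, div_le_iff₀ (by positivity), inv_mul_eq_div, le_div_iff₀ hy]
  nlinarith [sq_nonneg u]

theorem abs_halfPlaneConjPoisson_le_inv (hy : 0 < y) (u : ℝ) :
    |halfPlaneConjPoisson y u| ≤ y⁻¹ := by
  have hpos : 0 < u ^ 2 + y ^ 2 := by positivity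
  rw [halfPlaneConjPoisson, abs_div, abs_of_pos hpos, div_le_iff₀ hpos, inv_mul_eq_div,
    le_div_iff₀ hy]
  nlinarith [sq_nonneg (|u| - y), sq_abs u, sq_nonneg u, sq_nonneg y]

theorem integral_halfPlanePoisson (hy : 0 < y) : ∫ u, halfPlanePoisson y u = Real.pi := by
  have hscale : ∀ u, halfPlanePoisson y u = y⁻¹ * (1 + (y⁻¹ * u) ^ 2)⁻¹ := fun u => by
    rw [halfPlanePoisson]
    field_simp
    ring
  simp_rw [hscale]
  rw [integral_const_mul, Measure.integral_comp_mul_left (fun u : ℝ => (1 + u ^ 2)⁻¹) y⁻¹,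
    integral_univ_inv_one_add_sq, inv_inv, abs_of_pos hy, smul_eq_mul, inv_mul_cancel_left₀ hy.ne']

theorem integrable_halfPlanePoisson (hy : 0 < y) : Integrable (halfPlanePoisson y) :=
  .of_integral_ne_zero (by rw [integral_halfPlanePoisson hy]; exact Real.pi_ne_zero)

theorem exists_setOf_le_halfPlanePoisson_eq_closedBall (hy : 0 < y) (x : ℝ) {s : ℝ} (hs : 0 < s) :
    ∃ r, {t | s ≤ halfPlanePoisson y (x - t)} = closedBall x r := by
  have hlevel : ∀ t, s ≤ halfPlanePoisson y (x - t) ↔ dist t x ^ 2 ≤ y / s - y ^ 2 := fun t => by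
    rw [halfPlanePoisson, le_div_iff₀ (by positivity), Real.dist_eq, sq_abs, ← neg_sub x t, neg_sq,
      le_sub_iff_add_le, le_div_iff₀' hs]
  rcases le_or_gt 0 (y / s - y ^ 2) with hpos | hneg
  · refine ⟨√(y / s - y ^ 2), ?_⟩
    ext t
    rw [mem_ofPred_eq, hlevel, mem_closedBall, Real.le_sqrt dist_nonneg hpos]
  · refine ⟨-1, ?_⟩
    ext t
    simp only [mem_ofPred_eq, hlevel, mem_closedBall]
    constructor <;> intro h <;> nlinarith [dist_nonneg (x := t) (y := x), sq_nonneg (dist t x)]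

theorem halfPlanePoisson_le_mul_one (hy : 0 < y) (u : ℝ) :
    halfPlanePoisson y u ≤ (y + y⁻¹) * halfPlanePoisson 1 u := by
  have hexpand : (y + y⁻¹) * (u ^ 2 + y ^ 2) = y * (u ^ 2 + 1 ^ 2) + (y ^ 3 + y⁻¹ * u ^ 2) := by
    field_simp
    ring
  rw [halfPlanePoisson, halfPlanePoisson, mul_one_div,
    div_le_div_iff₀ (by positivity) (by positivity), hexpand]
  exact le_add_of_nonneg_right (by positivity)

theorem halfPlanePoisson_le_mul_one_of_le_abs (hy : 0 < y) {δ u : ℝ} (hδ : 0 < δ) (hu : δ ≤ |u|) :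
    halfPlanePoisson y u ≤ y * (1 + (δ ^ 2)⁻¹) * halfPlanePoisson 1 u := by
  have hδu : 1 ≤ (δ ^ 2)⁻¹ * u ^ 2 := by
    rw [inv_mul_eq_div, one_le_div (by positivity), ← sq_abs u]
    gcongr
  rw [halfPlanePoisson, halfPlanePoisson, mul_one_div, mul_div_assoc, div_eq_mul_inv y]
  gcongr
  rw [inv_eq_one_div, div_le_div_iff₀ (by positivity) (by positivity)]
  nlinarith [mul_nonneg (inv_nonneg.2 (sq_nonneg δ)) (sq_nonneg y), sq_nonneg y]

theorem inv_le_two_mul_halfPlanePoisson (hy : 0 < y) {u : ℝ} (hu : |u| ≤ y) :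
    y⁻¹ ≤ 2 * halfPlanePoisson y u := by
  have hsq : u ^ 2 ≤ y ^ 2 := sq_le_sq' (abs_le.1 hu).1 (abs_le.1 hu).2
  rw [halfPlanePoisson, mul_div_assoc', inv_eq_one_div, div_le_div_iff₀ hy (by positivity)]
  nlinarith

theorem div_sq_le_two_mul_halfPlanePoisson (hy : 0 < y) {u : ℝ} (hu : y < |u|) :
    y / u ^ 2 ≤ 2 * halfPlanePoisson y u := by
  have hsq : y ^ 2 < u ^ 2 := sq_abs u ▸ pow_lt_pow_left₀ hu hy.le two_ne_zero
  have hu2 : 0 < u ^ 2 := (sq_nonneg y).trans_lt hsq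
  rw [halfPlanePoisson, mul_div_assoc', div_le_div_iff₀ hu2 (by positivity)]
  nlinarith

end PoissonKernel

section LebesguePoints

theorem lintegral_mul_le_of_setLIntegral_superlevel_le {α : Type*} [MeasurableSpace α]
    {μ : Measure α} {k : α → ℝ} (hk : Measurable k) (hk0 : 0 ≤ k) {h : α → ℝ≥0∞}
    (hh : AEMeasurable h μ) {C : ℝ≥0∞}
    (hC : ∀ s, 0 < s → ∫⁻ t in {t | s ≤ k t}, h t ∂μ ≤ C * μ {t | s ≤ k t}) :
    ∫⁻ t, ENNReal.ofReal (k t) * h t ∂μ ≤ C * ∫⁻ t, ENNReal.ofReal (k t) ∂μ := by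
  have hanti : Antitone fun s : ℝ => μ {t | s ≤ k t} := fun _ _ hst =>
    measure_mono fun _ ht => hst.trans ht
  calc ∫⁻ t, ENNReal.ofReal (k t) * h t ∂μ
      = ∫⁻ t, ENNReal.ofReal (k t) ∂μ.withDensity h := by
        rw [lintegral_withDensity_eq_lintegral_mul₀ hh hk.ennreal_ofReal.aemeasurable]
        simp only [Pi.mul_apply, mul_comm]
    _ = ∫⁻ s in Ioi (0 : ℝ), μ.withDensity h {t | s ≤ k t} :=
        lintegral_eq_lintegral_meas_le _ (.of_forall hk0) hk.aemeasurable
    _ ≤ ∫⁻ s in Ioi (0 : ℝ), C * μ {t | s ≤ k t} :=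
        setLIntegral_mono (hanti.measurable.const_mul C) fun s hs => by
          rw [withDensity_apply _ (measurableSet_le measurable_const hk)]
          exact hC s hs
    _ = C * ∫⁻ t, ENNReal.ofReal (k t) ∂μ := by
        rw [lintegral_const_mul _ hanti.measurable,
          lintegral_eq_lintegral_meas_le _ (.of_forall hk0) hk.aemeasurable]

theorem lintegral_halfPlanePoisson_mul_le {x y : ℝ} (hy : 0 < y) {h : ℝ → ℝ≥0∞}
    (hh : AEMeasurable h) {C : ℝ≥0∞}
    (hC : ∀ r, 0 < r → ∫⁻ t in closedBall x r, h t ≤ C * volume (closedBall x r)) :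
    ∫⁻ t, ENNReal.ofReal (halfPlanePoisson y (x - t)) * h t ≤ C * ENNReal.ofReal Real.pi := by
  have hmass : ∫⁻ t, ENNReal.ofReal (halfPlanePoisson y (x - t)) = ENNReal.ofReal Real.pi := by
    rw [← ofReal_integral_eq_lintegral_ofReal ((integrable_halfPlanePoisson hy).comp_sub_left x)
      (.of_forall fun t => (halfPlanePoisson_pos hy _).le),
      integral_sub_left_eq_self (halfPlanePoisson y) volume x, integral_halfPlanePoisson hy]
  rw [← hmass]
  refine lintegral_mul_le_of_setLIntegral_superlevel_le (k := fun t => halfPlanePoisson y (x - t))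
    ((measurable_halfPlanePoisson y).comp (measurable_const.sub measurable_id))
    (fun t => (halfPlanePoisson_pos hy _).le) hh fun s hs => ?_
  obtain ⟨r, hr⟩ := exists_setOf_le_halfPlanePoisson_eq_closedBall hy x hs
  rw [hr]
  rcases lt_or_ge 0 r with hr0 | hr0
  · exact hC r hr0
  · have hnull : volume (closedBall x r) = 0 := by
      rw [Real.volume_closedBall, ENNReal.ofReal_eq_zero]
      linarith
    simp only [setLIntegral_measure_zero _ _ hnull, zero_le]

variable {E : Type*} [NormedAddCommGroup E] {g : ℝ → E} {x : ℝ}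

/-- The point `x` is a Lebesgue point of `g`, with the value `g x`: the mean oscillation of `g`
around `g x` over the balls centered at `x` tends to zero. -/
def IsLebesguePoint (g : ℝ → E) (x : ℝ) : Prop :=
  Tendsto (fun r => ⨍⁻ t in closedBall x r, ‖g t - g x‖ₑ ∂volume) (𝓝[>] 0) (𝓝 0)

theorem ae_isLebesguePoint (hg : LocallyIntegrable g) : ∀ᵐ x, IsLebesguePoint g x := by
  filter_upwards
    [(IsUnifLocDoublingMeasure.vitaliFamily volume 1).ae_tendsto_lintegral_enorm_sub_div hg]
    with x hx
  have hballs : Tendsto (closedBall x) (𝓝[>] 0)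
      ((IsUnifLocDoublingMeasure.vitaliFamily volume 1).filterAt x) := by
    refine IsUnifLocDoublingMeasure.tendsto_closedBall_filterAt volume (fun _ => x) id tendsto_id ?_
    filter_upwards [self_mem_nhdsWithin] with r hr
    simpa using (mem_Ioi.1 hr).le
  exact (hx.comp hballs).congr fun r => (setLAverage_eq (μ := volume) _ _).symm

theorem IsLebesguePoint.exists_setLIntegral_inter_closedBall_le (h : IsLebesguePoint g x)
    {ε : ℝ≥0∞} (hε : 0 < ε) :
    ∃ δ > 0, ∀ r > 0, ∫⁻ t in closedBall x r ∩ closedBall x δ, ‖g t - g x‖ₑ ≤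
      ε * volume (closedBall x r) := by
  obtain ⟨δ₀, hδ₀, hsub⟩ := mem_nhdsGT_iff_exists_Ioo_subset.1 (ENNReal.tendsto_nhds_zero.1 h ε hε)
  have hsmall : ∀ r, 0 < r → r < δ₀ → ∫⁻ t in closedBall x r, ‖g t - g x‖ₑ ≤
      ε * volume (closedBall x r) := fun r hr hrδ => by
    have havg : ⨍⁻ t in closedBall x r, ‖g t - g x‖ₑ ∂volume ≤ ε := hsub ⟨hr, hrδ⟩
    rwa [setLAverage_eq, ENNReal.div_le_iff (measure_closedBall_pos _ _ hr).ne'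
      measure_closedBall_lt_top.ne] at havg
  obtain ⟨δ, hδ, hδδ₀⟩ := exists_between (mem_Ioi.1 hδ₀)
  refine ⟨δ, hδ, fun r hr => ?_⟩
  rcases le_total r δ with hrδ | hδr
  · rw [inter_eq_left.2 (closedBall_subset_closedBall hrδ)]
    exact hsmall r hr (hrδ.trans_lt hδδ₀)
  · rw [inter_eq_right.2 (closedBall_subset_closedBall hδr)]
    refine (hsmall δ hδ hδδ₀).trans ?_
    gcongr

variable [NormedSpace ℝ E]

theorem aestronglyMeasurable_of_integrable_halfPlanePoisson_smul
    (hg : Integrable fun t => halfPlanePoisson 1 (x - t) • g t) : AEStronglyMeasurable g := by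
  have hmeas : Measurable fun t => (halfPlanePoisson 1 (x - t))⁻¹ :=
    ((measurable_halfPlanePoisson 1).comp (measurable_const.sub measurable_id)).inv
  refine (hmeas.aestronglyMeasurable.smul hg.1).congr (.of_forall fun t => ?_)
  exact inv_smul_smul₀ (halfPlanePoisson_pos one_pos _).ne' (g t)

theorem lintegral_halfPlanePoisson_mul_enorm_sub_ne_top
    (hg : Integrable fun t => halfPlanePoisson 1 (x - t) • g t) (a : E) :
    ∫⁻ t, ENNReal.ofReal (halfPlanePoisson 1 (x - t)) * ‖g t - a‖ₑ ≠ ⊤ := by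
  have hsub := hg.sub (((integrable_halfPlanePoisson one_pos).comp_sub_left x).smul_const a)
  refine ne_of_eq_of_ne (lintegral_congr fun t => ?_) hsub.2.ne
  rw [Pi.sub_apply, ← smul_sub, enorm_smul,
    Real.enorm_of_nonneg (halfPlanePoisson_pos one_pos _).le]

theorem setLIntegral_compl_closedBall_halfPlanePoisson_mul_le {y δ : ℝ} (hy : 0 < y) (hδ : 0 < δ)
    (x : ℝ) (h : ℝ → ℝ≥0∞) :
    ∫⁻ t in (closedBall x δ)ᶜ, ENNReal.ofReal (halfPlanePoisson y (x - t)) * h t ≤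
      ENNReal.ofReal (y * (1 + (δ ^ 2)⁻¹)) *
        ∫⁻ t, ENNReal.ofReal (halfPlanePoisson 1 (x - t)) * h t := by
  rw [← lintegral_const_mul' _ _ ENNReal.ofReal_ne_top]
  refine (setLIntegral_mono_ae' measurableSet_closedBall.compl (.of_forall fun t ht => ?_)).trans
    (setLIntegral_le_lintegral _ _)
  rw [mem_compl_iff, mem_closedBall', Real.dist_eq, not_le] at ht
  rw [← mul_assoc, ← ENNReal.ofReal_mul (by positivity)]
  gcongr
  exact halfPlanePoisson_le_mul_one_of_le_abs hy hδ ht.le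

theorem integrable_smul_of_abs_le_halfPlanePoisson
    (hg : Integrable fun t => halfPlanePoisson 1 (x - t) • g t) {k : ℝ → ℝ} (hk : Measurable k)
    {B y : ℝ} (hy : 0 < y) (hle : ∀ u, |k u| ≤ B * halfPlanePoisson y u) :
    Integrable fun t => k (x - t) • g t := by
  have hB : 0 ≤ B :=
    nonneg_of_mul_nonneg_left ((abs_nonneg _).trans (hle 0)) (halfPlanePoisson_pos hy 0)
  refine (hg.norm.const_mul (B * (y + y⁻¹))).mono'
    ((hk.comp (measurable_const.sub measurable_id)).aestronglyMeasurable.smul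
      (aestronglyMeasurable_of_integrable_halfPlanePoisson_smul hg)) (.of_forall fun t => ?_)
  rw [norm_smul, norm_smul, Real.norm_of_nonneg (halfPlanePoisson_pos one_pos _).le, ← mul_assoc,
    mul_assoc B]
  gcongr
  exact (hle _).trans (mul_le_mul_of_nonneg_left (halfPlanePoisson_le_mul_one hy _) hB)

namespace IsLebesguePoint

theorem tendsto_lintegral_halfPlanePoisson_mul (h : IsLebesguePoint g x)
    (hg : Integrable fun t => halfPlanePoisson 1 (x - t) • g t) :
    Tendsto (fun y => ∫⁻ t, ENNReal.ofReal (halfPlanePoisson y (x - t)) * ‖g t - g x‖ₑ)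
      (𝓝[>] 0) (𝓝 0) := by
  have hmeas : AEMeasurable fun t => ‖g t - g x‖ₑ :=
    ((aestronglyMeasurable_of_integrable_halfPlanePoisson_smul hg).sub
      aestronglyMeasurable_const).enorm
  refine ENNReal.tendsto_nhds_zero.2 fun ε hε => ?_
  have hπ : ENNReal.ofReal Real.pi ≠ 0 := by simpa using Real.pi_pos
  obtain ⟨δ, hδ, hnear⟩ := h.exists_setLIntegral_inter_closedBall_le
    (ENNReal.div_pos (ENNReal.half_pos hε.ne').ne' (ENNReal.ofReal_ne_top (r := Real.pi)))
  have hfar : Tendsto (fun y => ENNReal.ofReal (y * (1 + (δ ^ 2)⁻¹)) *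
      ∫⁻ t, ENNReal.ofReal (halfPlanePoisson 1 (x - t)) * ‖g t - g x‖ₑ) (𝓝[>] 0) (𝓝 0) := by
    have hlin : Continuous fun y : ℝ => y * (1 + (δ ^ 2)⁻¹) := by fun_prop
    have hfactor := ENNReal.tendsto_ofReal
      ((hlin.tendsto 0).mono_left (nhdsWithin_le_nhds (s := Ioi 0)))
    rw [zero_mul, ENNReal.ofReal_zero] at hfactor
    simpa only [zero_mul] using ENNReal.Tendsto.mul_const hfactor
      (Or.inr (lintegral_halfPlanePoisson_mul_enorm_sub_ne_top hg (g x)))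
  filter_upwards [self_mem_nhdsWithin,
    ENNReal.tendsto_nhds_zero.1 hfar (ε / 2) (ENNReal.half_pos hε.ne')] with y hy hyε
  rw [← lintegral_add_compl _ (measurableSet_closedBall (x := x) (ε := δ)), ← ENNReal.add_halves ε]
  refine add_le_add ?_
    ((setLIntegral_compl_closedBall_halfPlanePoisson_mul_le hy hδ x _).trans hyε)
  rw [← lintegral_indicator measurableSet_closedBall]
  simp only [indicator_mul_right]
  rw [← ENNReal.div_mul_cancel (b := ε / 2) hπ ENNReal.ofReal_ne_top]
  refine lintegral_halfPlanePoisson_mul_le hy (hmeas.indicator measurableSet_closedBall)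
    fun r hr => ?_
  rw [setLIntegral_indicator measurableSet_closedBall, inter_comm]
  exact hnear r hr

variable [CompleteSpace E]

theorem tendsto_integral_smul (h : IsLebesguePoint g x)
    (hg : Integrable fun t => halfPlanePoisson 1 (x - t) • g t) {D : ℝ → ℝ → ℝ} {B c : ℝ}
    (hD : ∀ y, Measurable (D y)) (hle : ∀ y, 0 < y → ∀ u, |D y u| ≤ B * halfPlanePoisson y u)
    (hc : ∀ y, 0 < y → ∫ u, D y u = c) :
    Tendsto (fun y => ∫ t, D y (x - t) • g t) (𝓝[>] 0) (𝓝 (c • g x)) := by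
  have hosc : Tendsto (fun y => ∫ t, D y (x - t) • (g t - g x)) (𝓝[>] 0) (𝓝 0) := by
    have hbound := ENNReal.Tendsto.const_mul (a := ENNReal.ofReal B)
      (h.tendsto_lintegral_halfPlanePoisson_mul hg) (Or.inr ENNReal.ofReal_ne_top)
    rw [mul_zero] at hbound
    refine tendsto_zero_iff_enorm_tendsto_zero.2 <| tendsto_of_tendsto_of_tendsto_of_le_of_le'
      tendsto_const_nhds hbound (.of_forall fun _ => zero_le) ?_
    filter_upwards [self_mem_nhdsWithin] with y hy
    refine (enorm_integral_le_lintegral_enorm _).trans ?_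
    rw [← lintegral_const_mul' _ _ ENNReal.ofReal_ne_top]
    refine lintegral_mono fun t => ?_
    rw [enorm_smul, ← mul_assoc, ← ENNReal.ofReal_mul' (halfPlanePoisson_pos hy _).le,
      Real.enorm_eq_ofReal_abs]
    gcongr
    exact hle y hy _
  rw [← zero_add (c • g x)]
  refine (hosc.add_const (c • g x)).congr' ?_
  filter_upwards [self_mem_nhdsWithin] with y hy
  have hDint : Integrable (D y) := ((integrable_halfPlanePoisson hy).const_mul B).mono'
    (hD y).aestronglyMeasurable (.of_forall (hle y hy))
  have hconst : ∫ t, D y (x - t) • g x = c • g x := by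
    rw [integral_smul_const, integral_sub_left_eq_self (D y) volume x, hc y hy]
  simp_rw [smul_sub]
  rw [integral_sub (integrable_smul_of_abs_le_halfPlanePoisson hg (hD y) hy (hle y hy))
    ((hDint.comp_sub_left x).smul_const (g x)), hconst, sub_add_cancel]

theorem tendsto_integral_halfPlanePoisson_smul (h : IsLebesguePoint g x)
    (hg : Integrable fun t => halfPlanePoisson 1 (x - t) • g t) :
    Tendsto (fun y => ∫ t, halfPlanePoisson y (x - t) • g t) (𝓝[>] 0) (𝓝 (Real.pi • g x)) :=
  h.tendsto_integral_smul hg (B := 1) measurable_halfPlanePoisson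
    (fun y hy u => by rw [one_mul, abs_of_pos (halfPlanePoisson_pos hy u)])
    fun _ => integral_halfPlanePoisson

/-- The difference of the two kernels is odd, so it has integral zero. -/
theorem tendsto_integral_smul_of_odd (h : IsLebesguePoint g x)
    (hg : Integrable fun t => halfPlanePoisson 1 (x - t) • g t) {K L : ℝ → ℝ → ℝ} {B : ℝ}
    (hK : ∀ y, Measurable (K y)) (hL : ∀ y, Measurable (L y))
    (hKodd : ∀ y, Function.Odd (K y)) (hLodd : ∀ y, Function.Odd (L y))
    (hKL : ∀ y, 0 < y → ∀ u, |L y u - K y u| ≤ B * halfPlanePoisson y u)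
    (hKint : ∀ y, 0 < y → Integrable fun t => K y (x - t) • g t) {l : E}
    (hlim : Tendsto (fun y => ∫ t, K y (x - t) • g t) (𝓝[>] 0) (𝓝 l)) :
    Tendsto (fun y => ∫ t, L y (x - t) • g t) (𝓝[>] 0) (𝓝 l) := by
  have hDmeas : ∀ y, Measurable fun u => L y u - K y u := fun y => (hL y).sub (hK y)
  have hdiff := h.tendsto_integral_smul hg hDmeas hKL fun y _ =>
    integral_eq_zero_of_odd fun u => by rw [hLodd y, hKodd y, neg_sub_neg, neg_sub]
  rw [zero_smul] at hdiff
  rw [← add_zero l]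
  refine (hlim.add hdiff).congr' ?_
  filter_upwards [self_mem_nhdsWithin] with y hy
  rw [← integral_add (hKint y hy)
    (integrable_smul_of_abs_le_halfPlanePoisson hg (hDmeas y) hy (hKL y hy))]
  simp_rw [← add_smul, add_sub_cancel]

end IsLebesguePoint

end LebesguePoints

section UpperHalfPlane

open Bornology
open scoped ComplexConjugate

variable {E : Type*} [NormedAddCommGroup E] [NormedSpace ℂ E]

theorem norm_integral_le_of_differentiableOn_upperHalfPlane {h : ℂ → E}
    (hd : DifferentiableOn ℂ h {w | 0 ≤ w.im}) {R C : ℝ} (hR : 0 < R)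
    (hC : ∀ w : ℂ, 0 ≤ w.im → R ≤ ‖w‖ → ‖h w‖ ≤ C) : ‖∫ t in (-R)..R, h t‖ ≤ 4 * R * C := by
  have hrect := Complex.integral_boundary_rect_eq_zero_of_differentiableOn h (-R : ℂ)
    (R + R * Complex.I) (hd.mono fun w hw => by
      have him := hw.2
      simp only [Complex.neg_im, Complex.ofReal_im, neg_zero, Complex.add_im, Complex.mul_im,
        Complex.ofReal_re, Complex.I_im, mul_one, Complex.I_re, mul_zero, add_zero, zero_add,
        uIcc_of_le hR.le] at him
      exact him.1)
  simp only [Complex.neg_re, Complex.ofReal_re, Complex.add_re, Complex.mul_re, Complex.I_re,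
    mul_zero, Complex.ofReal_im, Complex.I_im, mul_one, sub_self, add_zero, Complex.neg_im,
    neg_zero, Complex.ofReal_zero, zero_mul, Complex.add_im, Complex.mul_im, zero_add,
    Complex.ofReal_neg] at hrect
  have htop : ‖∫ t in (-R)..R, h (t + R * Complex.I)‖ ≤ C * |R - -R| :=
    intervalIntegral.norm_integral_le_of_norm_le_const fun t _ => hC _ (by simpa using hR.le)
      (by simpa [abs_of_pos hR] using Complex.abs_im_le_norm (t + R * Complex.I))
  have hside : ∀ a : ℝ, |a| = R → ‖∫ t in (0 : ℝ)..R, h (a + t * Complex.I)‖ ≤ C * |R - 0| :=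
    fun a ha => intervalIntegral.norm_integral_le_of_norm_le_const fun t ht =>
      hC _ (by simpa using (uIoc_of_le hR.le ▸ ht).1.le)
        (by simpa [ha] using Complex.abs_re_le_norm (a + t * Complex.I))
  have hright := hside R (abs_of_pos hR)
  have hleft := hside (-R) (by rw [abs_neg, abs_of_pos hR])
  have hsum : ∫ t in (-R)..R, h t = (∫ t in (-R)..R, h (t + R * Complex.I)) -
      Complex.I • (∫ t in (0 : ℝ)..R, h (R + t * Complex.I)) +
      Complex.I • ∫ t in (0 : ℝ)..R, h (-R + t * Complex.I) := by
    rw [← sub_eq_zero, ← hrect]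
    abel
  calc ‖∫ t in (-R)..R, h t‖
      ≤ ‖∫ t in (-R)..R, h (t + R * Complex.I)‖ +
        ‖Complex.I • ∫ t in (0 : ℝ)..R, h (R + t * Complex.I)‖ +
        ‖Complex.I • ∫ t in (0 : ℝ)..R, h (-R + t * Complex.I)‖ := by
        rw [hsum]
        exact (norm_add_le _ _).trans (by gcongr; exact norm_sub_le _ _)
    _ ≤ C * |R - -R| + C * |R - 0| + C * |R - 0| := by
        rw [norm_smul, norm_smul, Complex.norm_I, one_mul, one_mul]
        push_cast at hleft
        gcongr
    _ = 4 * R * C := by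
        rw [sub_zero, sub_neg_eq_add, abs_of_pos hR, abs_of_pos (by positivity)]
        ring

theorem integral_eq_zero_of_differentiableOn_upperHalfPlane {h : ℂ → E}
    (hd : DifferentiableOn ℂ h {w | 0 ≤ w.im})
    (hdecay : Tendsto (fun w => ‖w‖ * ‖h w‖) (cobounded ℂ ⊓ 𝓟 {w | 0 ≤ w.im}) (𝓝 0))
    (hi : Integrable fun t : ℝ => h t) : ∫ t : ℝ, h t = 0 := by
  have hlim : Tendsto (fun R : ℝ => ∫ t in (-R)..R, h t) atTop (𝓝 (∫ t : ℝ, h t)) :=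
    intervalIntegral_tendsto_integral hi tendsto_neg_atTop_atBot tendsto_id
  refine tendsto_nhds_unique hlim (NormedAddGroup.tendsto_nhds_zero.2 fun ε hε => ?_)
  have hsmall : ∀ᶠ w in cobounded ℂ, 0 ≤ w.im → ‖w‖ * ‖h w‖ < ε / 8 :=
    eventually_inf_principal.1 (hdecay.eventually_lt_const (by positivity))
  obtain ⟨R₀, -, hR₀⟩ := hasBasis_cobounded_norm.eventually_iff.1 hsmall
  filter_upwards [eventually_ge_atTop R₀, eventually_gt_atTop 0] with R hRR₀ hR
  calc ‖∫ t in (-R)..R, h t‖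
      ≤ 4 * R * (ε / 8 / R) :=
        norm_integral_le_of_differentiableOn_upperHalfPlane hd hR fun w hw hRw => by
          rw [le_div_iff₀' hR]
          exact (mul_le_mul_of_nonneg_right hRw (norm_nonneg _)).trans
            (hR₀ (mem_ofPred_eq ▸ hRR₀.trans hRw) hw).le
    _ = ε / 2 := by
        field_simp
        norm_num
    _ < ε := half_lt_self hε

theorem ofReal_sub_mul_ofReal_sub_conj (z : ℂ) (t : ℝ) :
    ((t : ℂ) - z) * (t - conj z) = (((z.re - t) ^ 2 + z.im ^ 2 : ℝ) : ℂ) := by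
  have hconj : (t : ℂ) - conj z = conj ((t : ℂ) - z) := by rw [map_sub, Complex.conj_ofReal]
  rw [hconj, Complex.mul_conj, Complex.normSq_apply]
  congr 1
  simp only [Complex.sub_re, Complex.ofReal_re, Complex.sub_im, Complex.ofReal_im]
  ring

theorem tendsto_norm_mul_norm_inv_smul_dslope {Ψ : ℂ → E} {M : ℝ}
    (hM : ∀ w : ℂ, 0 ≤ w.im → ‖Ψ w‖ ≤ M) {z : ℂ} (hz : 0 ≤ z.im) :
    Tendsto (fun w => ‖w‖ * ‖(w - conj z)⁻¹ • dslope Ψ z w‖)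
      (cobounded ℂ ⊓ 𝓟 {w | 0 ≤ w.im}) (𝓝 0) := by
  have hinv : Tendsto (fun w : ℂ => 8 * M * ‖w‖⁻¹) (cobounded ℂ ⊓ 𝓟 {w | 0 ≤ w.im}) (𝓝 0) := by
    rw [← mul_zero (8 * M)]
    exact (tendsto_norm_cobounded_atTop.inv_tendsto_atTop.const_mul (8 * M)).mono_left inf_le_left
  refine squeeze_zero' (.of_forall fun w => by positivity) ?_ hinv
  refine eventually_inf_principal.2 ?_
  filter_upwards [tendsto_norm_cobounded_atTop.eventually_ge_atTop (2 * ‖z‖),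
    tendsto_norm_cobounded_atTop.eventually_gt_atTop ‖z‖] with w hwz2 hwz hw
  have hw0 : 0 < ‖w‖ := (norm_nonneg z).trans_lt hwz
  have hne : w ≠ z := fun heq => hwz.ne' (congrArg norm heq)
  have hsub : ‖w‖ / 2 ≤ ‖w - z‖ := by linarith [norm_sub_norm_le w z]
  have hsubconj : ‖w‖ / 2 ≤ ‖w - conj z‖ := by
    linarith [norm_sub_norm_le w (conj z), Complex.norm_conj z]
  have hnum : ‖Ψ w - Ψ z‖ ≤ 2 * M := (norm_sub_le _ _).trans (by linarith [hM w hw, hM z hz])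
  rw [dslope_of_ne _ hne, slope_def_module, norm_smul, norm_smul, norm_inv, norm_inv]
  calc ‖w‖ * (‖w - conj z‖⁻¹ * (‖w - z‖⁻¹ * ‖Ψ w - Ψ z‖))
      ≤ ‖w‖ * ((‖w‖ / 2)⁻¹ * ((‖w‖ / 2)⁻¹ * (2 * M))) := by gcongr
    _ = 8 * M * ‖w‖⁻¹ := by
        field_simp
        ring

theorem integral_halfPlanePoisson_smul_of_bounded [CompleteSpace E] {Ψ : ℂ → E} {M : ℝ}
    (hd : DifferentiableOn ℂ Ψ {w | 0 ≤ w.im}) (hM : ∀ w : ℂ, 0 ≤ w.im → ‖Ψ w‖ ≤ M)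
    {z : ℂ} (hz : 0 < z.im) :
    ∫ t : ℝ, halfPlanePoisson z.im (z.re - t) • Ψ t = Real.pi • Ψ z := by
  have hne : ∀ t : ℝ, (t : ℂ) ≠ z := fun t heq => hz.ne' (heq ▸ Complex.ofReal_im t)
  have hmem : {w : ℂ | 0 ≤ w.im} ∈ 𝓝 z :=
    mem_of_superset ((isOpen_lt continuous_const Complex.continuous_im).mem_nhds hz)
      fun w (hw : 0 < w.im) => hw.le
  have hcont : Continuous fun t : ℝ => Ψ t :=
    hd.continuousOn.comp_continuous Complex.continuous_ofReal fun t => (Complex.ofReal_im t).ge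
  have hP : Integrable fun t => halfPlanePoisson z.im (z.re - t) :=
    (integrable_halfPlanePoisson hz).comp_sub_left z.re
  have hPΨ : Integrable fun t : ℝ => halfPlanePoisson z.im (z.re - t) • Ψ t :=
    hP.smul_bdd M hcont.aestronglyMeasurable
      (.of_forall fun t => hM t (Complex.ofReal_im t).ge)
  have hkernel : ∀ t : ℝ, halfPlanePoisson z.im (z.re - t) • Ψ t -
      halfPlanePoisson z.im (z.re - t) • Ψ z = z.im • ((t - conj z)⁻¹ • dslope Ψ z t) := fun t => by
    rw [← smul_sub, dslope_of_ne _ (hne t), slope_def_module, smul_smul, ← mul_inv_rev,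
      ofReal_sub_mul_ofReal_sub_conj, halfPlanePoisson, div_eq_mul_inv, mul_smul,
      ← Complex.ofReal_inv, Complex.coe_smul]
  have hdiff : Integrable fun t : ℝ => (t - conj z)⁻¹ • dslope Ψ z t := by
    refine ((hPΨ.sub (hP.smul_const (Ψ z))).smul z.im⁻¹).congr (.of_forall fun t => ?_)
    simp only [Pi.smul_apply, Pi.sub_apply, hkernel, inv_smul_smul₀ hz.ne']
  have hzero : ∫ t : ℝ, (t - conj z)⁻¹ • dslope Ψ z t = 0 := by
    refine integral_eq_zero_of_differentiableOn_upperHalfPlane (DifferentiableOn.smul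
      (DifferentiableOn.inv (by fun_prop) fun w hw heq => ?_)
      ((Complex.differentiableOn_dslope hmem).2 hd))
      (tendsto_norm_mul_norm_inv_smul_dslope hM hz.le) hdiff
    have him := congrArg Complex.im heq
    simp only [Complex.sub_im, Complex.conj_im, sub_neg_eq_add, Complex.zero_im] at him
    linarith [mem_ofPred_eq ▸ hw]
  rw [← sub_eq_zero, ← integral_halfPlanePoisson hz,
    ← integral_sub_left_eq_self (halfPlanePoisson z.im) volume z.re, ← integral_smul_const,
    ← integral_sub hPΨ (hP.smul_const _)]
  simp_rw [hkernel]
  rw [integral_smul, hzero, smul_zero]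

end UpperHalfPlane

section HardySpace

open scoped ComplexConjugate

theorem exists_tendsto_inner_of_norm_le {𝕜 H : Type*} [RCLike 𝕜] [NormedAddCommGroup H]
    [InnerProductSpace 𝕜 H] [CompleteSpace H] {ι : Type*} (U : Ultrafilter ι) {u : ι → H} {M : ℝ}
    (hu : ∀ n, ‖u n‖ ≤ M) :
    ∃ v : H, ∀ w, Tendsto (fun n => inner 𝕜 (u n) w) U (𝓝 (inner 𝕜 v w)) := by
  let φ : ι → WeakDual 𝕜 H := fun n => StrongDual.toWeakDual (InnerProductSpace.toDual 𝕜 H (u n))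
  have hφ : ∀ n, φ n ∈ WeakDual.toStrongDual ⁻¹' closedBall (0 : StrongDual 𝕜 H) M := by
    intro n
    simpa [φ] using hu n
  obtain ⟨ψ, -, hψ⟩ := (WeakDual.isCompact_closedBall (𝕜 := 𝕜) (0 : StrongDual 𝕜 H)
    M).ultrafilter_le_nhds (U.map φ) (le_principal_iff.2 (mem_map.2 (Filter.univ_mem' hφ)))
  have hlim : Tendsto φ U (𝓝 ψ) := hψ
  refine ⟨(InnerProductSpace.toDual 𝕜 H).symm (WeakDual.toStrongDual ψ), fun w => ?_⟩
  rw [InnerProductSpace.toDual_symm_apply]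
  exact ((WeakDual.eval_continuous (𝕜 := 𝕜) w).tendsto ψ).comp hlim

theorem memLp_two_halfPlanePoisson (x : ℝ) {y : ℝ} (hy : 0 < y) :
    MemLp (fun t => halfPlanePoisson y (x - t)) 2 := by
  have hint := (integrable_halfPlanePoisson hy).comp_sub_left x
  refine (memLp_two_iff_integrable_sq hint.1).2 <|
    (hint.const_mul y⁻¹).mono' (hint.1.pow 2) (.of_forall fun t => ?_)
  rw [Real.norm_of_nonneg (sq_nonneg _), sq]
  exact mul_le_mul_of_nonneg_right (halfPlanePoisson_le_inv hy _) (halfPlanePoisson_pos hy _).le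

theorem memLp_two_inv_ofReal_add_I : MemLp (fun t : ℝ => ((t : ℂ) + Complex.I)⁻¹) 2 := by
  have hmeas : AEStronglyMeasurable fun t : ℝ => ((t : ℂ) + Complex.I)⁻¹ := by fun_prop
  refine (memLp_two_iff_integrable_sq_norm hmeas).2 <|
    integrable_inv_one_add_sq.congr (.of_forall fun t => ?_)
  change (1 + t ^ 2)⁻¹ = ‖((t : ℂ) + Complex.I)⁻¹‖ ^ 2
  rw [norm_inv, inv_pow, ← Complex.normSq_eq_norm_sq, Complex.normSq_apply]
  simp [sq, add_comm]

theorem norm_ofReal_add_I_le (t : ℝ) {y : ℝ} (hy : 0 ≤ y) :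
    ‖(t : ℂ) + Complex.I‖ ≤ ‖(t : ℂ) + y * Complex.I + Complex.I‖ := by
  rw [← sq_le_sq₀ (norm_nonneg _) (norm_nonneg _), ← Complex.normSq_eq_norm_sq,
    ← Complex.normSq_eq_norm_sq, Complex.normSq_apply, Complex.normSq_apply]
  simp only [Complex.add_re, Complex.add_im, Complex.ofReal_re, Complex.ofReal_im, Complex.I_re,
    Complex.I_im, Complex.mul_re, Complex.mul_im]
  nlinarith

theorem inner_toLp_halfPlanePoisson (x y : ℝ)
    (hP : MemLp (fun t => (halfPlanePoisson y (x - t) : ℂ)) 2) (u : Lp ℂ 2 (volume : Measure ℝ)) :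
    inner ℂ (hP.toLp _) u = ∫ t, halfPlanePoisson y (x - t) • u t := by
  rw [L2.inner_def]
  refine integral_congr_ae ?_
  filter_upwards [hP.coeFn_toLp] with t ht
  rw [ht, RCLike.inner_apply', Complex.conj_ofReal, Complex.real_smul]

theorem im_add_ofReal_mul_I (z : ℂ) (δ : ℝ) : (z + δ * Complex.I).im = z.im + δ := by
  simp

theorem integral_halfPlanePoisson_smul_add_mul_I {Ψ : ℂ → ℂ}
    (hd : DifferentiableOn ℂ Ψ {w | 0 < w.im}) {δ M : ℝ} (hδ : 0 < δ)
    (hM : ∀ w : ℂ, δ ≤ w.im → ‖Ψ w‖ ≤ M) {z : ℂ} (hz : 0 < z.im) :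
    ∫ t : ℝ, halfPlanePoisson z.im (z.re - t) • Ψ (t + δ * Complex.I) =
      Real.pi • Ψ (z + δ * Complex.I) := by
  refine integral_halfPlanePoisson_smul_of_bounded (Ψ := fun w => Ψ (w + δ * Complex.I)) (M := M)
    (hd.comp (by fun_prop) fun w (hw : 0 ≤ w.im) => ?_) (fun w hw => hM _ ?_) hz
  · rw [mem_ofPred_eq, im_add_ofReal_mul_I]
    positivity
  · rw [im_add_ofReal_mul_I]
    exact le_add_of_nonneg_left hw

theorem exists_memLp_two_integral_halfPlanePoisson_smul {Ψ : ℂ → ℂ}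
    (hd : DifferentiableOn ℂ Ψ {w | 0 < w.im})
    (hbdd : ∀ δ > 0, ∃ M, ∀ w : ℂ, δ ≤ w.im → ‖Ψ w‖ ≤ M) {C : ℝ≥0∞} (hC : C ≠ ⊤)
    (hΨ : ∀ δ : ℝ, 0 < δ → eLpNorm (fun t : ℝ => Ψ (t + δ * Complex.I)) 2 ≤ C) :
    ∃ v : ℝ → ℂ, MemLp v 2 ∧ ∀ z : ℂ, 0 < z.im →
      ∫ t, halfPlanePoisson z.im (z.re - t) • v t = Real.pi • Ψ z := by
  let δ : ℕ → ℝ := fun n => 1 / ((n : ℝ) + 1)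
  have hδ : ∀ n, 0 < δ n := fun n => by positivity
  have hδlim : Tendsto δ atTop (𝓝 0) := tendsto_one_div_add_atTop_nhds_zero_nat
  have hmem : ∀ n, MemLp (fun t : ℝ => Ψ (t + δ n * Complex.I)) 2 := fun n =>
    ⟨(hd.continuousOn.comp_continuous (by fun_prop)
      fun t => by simpa using hδ n).aestronglyMeasurable, (hΨ _ (hδ n)).trans_lt hC.lt_top⟩
  have hnorm : ∀ n, ‖(hmem n).toLp _‖ ≤ C.toReal := fun n => by
    rw [Lp.norm_toLp]
    exact ENNReal.toReal_mono hC (hΨ _ (hδ n))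
  obtain ⟨v, hv⟩ := exists_tendsto_inner_of_norm_le (𝕜 := ℂ) (hyperfilter ℕ) hnorm
  refine ⟨v, Lp.memLp v, fun z hz => ?_⟩
  have hP : MemLp (fun t => (halfPlanePoisson z.im (z.re - t) : ℂ)) 2 :=
    (memLp_two_halfPlanePoisson z.re hz).ofReal
  have hweak : Tendsto (fun n => ∫ t, halfPlanePoisson z.im (z.re - t) • (hmem n).toLp _ t)
      (hyperfilter ℕ) (𝓝 (∫ t, halfPlanePoisson z.im (z.re - t) • v t)) := by
    have hconj := (Complex.continuous_conj.tendsto _).comp (hv (hP.toLp _))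
    simpa only [Function.comp_def, inner_conj_symm, inner_toLp_halfPlanePoisson _ _ hP] using hconj
  have hshift : ∀ n, ∫ t, halfPlanePoisson z.im (z.re - t) • (hmem n).toLp _ t =
      Real.pi • Ψ (z + δ n * Complex.I) := fun n => by
    obtain ⟨M, hM⟩ := hbdd (δ n) (hδ n)
    rw [← integral_halfPlanePoisson_smul_add_mul_I hd (hδ n) hM hz]
    refine integral_congr_ae ?_
    filter_upwards [(hmem n).coeFn_toLp] with t ht
    rw [ht]
  simp_rw [hshift] at hweak
  have hcont : ContinuousAt Ψ z := (hd.differentiableAt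
    ((isOpen_lt continuous_const Complex.continuous_im).mem_nhds hz)).continuousAt
  have hpoint : Tendsto (fun n => z + δ n * Complex.I) atTop (𝓝 z) := by
    simpa using (((Complex.continuous_ofReal.tendsto 0).comp hδlim).mul_const Complex.I).const_add z
  exact tendsto_nhds_unique hweak
    (((hcont.tendsto.comp hpoint).const_smul _).mono_left Nat.hyperfilter_le_atTop)

theorem integrable_halfPlanePoisson_smul_of_memLp_two {v : ℝ → ℂ} (hv : MemLp v 2) (x : ℝ) :
    Integrable fun t => halfPlanePoisson 1 (x - t) • v t := by
  exact memLp_one_iff_integrable.1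
    (hv.smul (f := v) (φ := fun t => halfPlanePoisson 1 (x - t))
      (memLp_two_halfPlanePoisson x one_pos))

/-- Division by `w + i` makes `f` square integrable on horizontal lines. -/
theorem ae_exists_tendsto_add_mul_I_of_bounded {f : ℂ → ℂ}
    (hd : DifferentiableOn ℂ f {w | 0 < w.im}) {M : ℝ} (hf : ∀ w : ℂ, 0 < w.im → ‖f w‖ ≤ M) :
    ∀ᵐ x : ℝ, ∃ L, Tendsto (fun y : ℝ => f (x + y * Complex.I)) (𝓝[>] 0) (𝓝 L) := by
  have hone : ∀ w : ℂ, 0 < w.im → 1 ≤ ‖w + Complex.I‖ := fun w hw =>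
    le_trans (by simpa using hw.le) ((le_abs_self _).trans (Complex.abs_im_le_norm _))
  have hne : ∀ w : ℂ, 0 < w.im → w + Complex.I ≠ 0 := fun w hw =>
    norm_pos_iff.1 (one_pos.trans_le (hone w hw))
  have hnorm : ∀ w : ℂ, 0 < w.im → ‖f w / (w + Complex.I)‖ ≤ M * ‖w + Complex.I‖⁻¹ := fun w hw => by
    rw [norm_div, div_eq_mul_inv]
    gcongr
    exact hf w hw
  have hM : 0 ≤ M := (norm_nonneg _).trans (hf Complex.I (by simp))
  obtain ⟨v, hv, hrepr⟩ := exists_memLp_two_integral_halfPlanePoisson_smul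
    (Ψ := fun w => f w / (w + Complex.I)) (hd.div (by fun_prop) fun w hw => hne w hw)
    (fun δ hδ => ⟨M, fun w hw => (hnorm w (hδ.trans_le hw)).trans <|
      mul_le_of_le_one_right hM (inv_le_one_of_one_le₀ (hone w (hδ.trans_le hw)))⟩)
    (memLp_two_inv_ofReal_add_I.const_mul (M : ℂ)).2.ne fun δ hδ => eLpNorm_mono fun t => by
      rw [norm_mul, Complex.norm_of_nonneg hM, norm_inv]
      refine (hnorm _ (by simpa using hδ)).trans ?_
      have hpos : 0 < ‖(t : ℂ) + Complex.I‖ :=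
        norm_pos_iff.2 fun heq => by simpa using congrArg Complex.im heq
      gcongr
      exact norm_ofReal_add_I_le t hδ.le
  filter_upwards [ae_isLebesguePoint (hv.locallyIntegrable one_le_two)] with x hx
  have hPv := hx.tendsto_integral_halfPlanePoisson_smul
    (integrable_halfPlanePoisson_smul_of_memLp_two hv x)
  have hfactor : Tendsto (fun y : ℝ => (x : ℂ) + y * Complex.I + Complex.I) (𝓝[>] 0)
      (𝓝 (x + (0 : ℝ) * Complex.I + Complex.I)) :=
    (Continuous.tendsto (by fun_prop) 0).mono_left nhdsWithin_le_nhds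
  refine ⟨_, ((hPv.const_smul Real.pi⁻¹).mul hfactor).congr' ?_⟩
  filter_upwards [self_mem_nhdsWithin] with y (hy : 0 < y)
  have him : 0 < ((x : ℂ) + y * Complex.I).im := by simpa using hy
  have hz := hrepr (x + y * Complex.I) him
  simp only [im_add_ofReal_mul_I, Complex.ofReal_im, zero_add, Complex.add_re, Complex.ofReal_re,
    Complex.re_ofReal_mul, Complex.I_re, mul_zero, add_zero] at hz
  rw [hz, inv_smul_smul₀ Real.pi_ne_zero, div_mul_cancel₀ _ (hne _ him)]

end HardySpace

section CauchyTransform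

theorem eq_of_continuousOn_of_exp_eq {k : ℝ → ℂ} {s : Set ℝ} (hs : IsPreconnected s)
    (hk : ContinuousOn k s) {c : ℂ} (hexp : ∀ y ∈ s, Complex.exp (k y) = c) {a b : ℝ}
    (ha : a ∈ s) (hb : b ∈ s) : k a = k b := by
  have hperiods : MapsTo (fun y => k y - k b) s
      (AddSubgroup.zmultiples (2 * Real.pi * Complex.I) : Set ℂ) := fun y hy => by
    have hone : Complex.exp (k y - k b) = 1 := by
      rw [Complex.exp_sub, hexp y hy, hexp b hb, div_self (hexp b hb ▸ Complex.exp_ne_zero _)]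
    obtain ⟨n, hn⟩ := Complex.exp_eq_one_iff.1 hone
    exact ⟨n, by simp only [zsmul_eq_mul, hn]⟩
  have hdiscrete := isDiscrete_iff_discreteTopology.2
    (NormedSpace.discreteTopology_zmultiples (2 * Real.pi * Complex.I))
  have heq : k a - k b = k b - k b :=
    hs.constant_of_mapsTo hdiscrete (hk.sub continuousOn_const) hperiods ha hb
  exact sub_left_injective heq

theorem exists_tendsto_of_tendsto_exp {γ : ℝ → ℂ} (hγ : ContinuousOn γ (Ioi 0)) {L : ℂ}
    (hL : L ≠ 0) (h : Tendsto (fun y => Complex.exp (γ y)) (𝓝[>] 0) (𝓝 L)) :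
    ∃ l, Tendsto γ (𝓝[>] 0) (𝓝 l) := by
  have hquot : Tendsto (fun y => Complex.exp (γ y) / L) (𝓝[>] 0) (𝓝 1) := by
    simpa only [div_self hL] using h.div_const L
  obtain ⟨δ, hδ, hslit⟩ := mem_nhdsGT_iff_exists_Ioo_subset.1
    (hquot.eventually (Complex.isOpen_slitPlane.mem_nhds Complex.one_mem_slitPlane))
  have hγδ : ContinuousOn γ (Ioo 0 δ) := hγ.mono Ioo_subset_Ioi_self
  have hcont : ContinuousOn (fun y => Complex.log (Complex.exp (γ y) / L) - γ y) (Ioo 0 δ) :=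
    (((Complex.continuous_exp.comp_continuousOn hγδ).div_const L).clog hslit).sub hγδ
  have hexp : ∀ y, Complex.exp (Complex.log (Complex.exp (γ y) / L) - γ y) = L⁻¹ := fun y => by
    have hne := Complex.exp_ne_zero (γ y)
    rw [Complex.exp_sub, Complex.exp_log (div_ne_zero hne hL)]
    field_simp
  obtain ⟨a, ha⟩ := nonempty_Ioo.2 (mem_Ioi.1 hδ)
  refine ⟨_, ((hquot.clog Complex.one_mem_slitPlane).sub_const
    (Complex.log (Complex.exp (γ a) / L) - γ a)).congr' ?_⟩
  filter_upwards [Ioo_mem_nhdsGT hδ] with y hy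
  rw [← eq_of_continuousOn_of_exp_eq isPreconnected_Ioo hcont (fun y _ => hexp y) hy ha,
    sub_sub_cancel]

/-- The Cauchy integral `∫ F(t) / (z - t) dt` of a function on the real line. -/
def cauchyTransform (F : ℝ → ℂ) (z : ℂ) : ℂ := ∫ t : ℝ, F t / (z - t)

variable {F G : ℝ → ℂ}

theorem im_le_norm_sub_ofReal (z : ℂ) (t : ℝ) : z.im ≤ ‖z - t‖ := by
  simpa using (le_abs_self _).trans (Complex.abs_im_le_norm (z - t))

theorem sub_ofReal_ne_zero {z : ℂ} (hz : 0 < z.im) (t : ℝ) : z - t ≠ 0 :=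
  norm_pos_iff.1 (hz.trans_le (im_le_norm_sub_ofReal z t))

theorem integrable_div_sub_ofReal (hF : Integrable F) {z : ℂ} (hz : 0 < z.im) :
    Integrable fun t : ℝ => F t / (z - t) := by
  simp_rw [div_eq_mul_inv]
  refine hF.mul_bdd (c := z.im⁻¹) ?_ (.of_forall fun t => ?_)
  · exact (Continuous.inv₀ (by fun_prop) (sub_ofReal_ne_zero hz)).aestronglyMeasurable
  · rw [norm_inv]
    exact inv_anti₀ hz (im_le_norm_sub_ofReal z t)

theorem cauchyTransform_add_const_mul (hF : Integrable F) (hG : Integrable G) (c : ℂ) {z : ℂ}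
    (hz : 0 < z.im) :
    cauchyTransform (fun t => F t + c * G t) z = cauchyTransform F z + c * cauchyTransform G z := by
  simp only [cauchyTransform]
  rw [← integral_const_mul, ← integral_add (integrable_div_sub_ofReal hF hz)
    ((integrable_div_sub_ofReal hG hz).const_mul c)]
  simp_rw [add_div, mul_div_assoc]

theorem half_im_lt_im_of_mem_ball {z w : ℂ} (hw : w ∈ ball z (z.im / 2)) : z.im / 2 < w.im := by
  have him := (Complex.abs_im_le_norm (w - z)).trans_lt (mem_ball_iff_norm.1 hw)
  rw [Complex.sub_im] at him
  linarith [(abs_lt.1 him).1]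

theorem differentiableOn_cauchyTransform (hF : Integrable F) :
    DifferentiableOn ℂ (cauchyTransform F) {w | 0 < w.im} := by
  intro z (hz : 0 < z.im)
  have hz2 : 0 < z.im / 2 := half_pos hz
  have hopen : IsOpen {w : ℂ | 0 < w.im} := isOpen_lt continuous_const Complex.continuous_im
  refine (hasDerivAt_integral_of_dominated_loc_of_deriv_le (𝕜 := ℂ)
    (F := fun (w : ℂ) (t : ℝ) => F t / (w - t)) (F' := fun w t => -F t / (w - t) ^ 2)
    (bound := fun t => ‖F t‖ * ((z.im / 2) ^ 2)⁻¹) (ball_mem_nhds z hz2)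
    ?_ (integrable_div_sub_ofReal hF hz) ?_ ?_ (hF.norm.mul_const _)
    ?_).2.differentiableAt.differentiableWithinAt
  · filter_upwards [hopen.mem_nhds hz] with w hw
    exact (integrable_div_sub_ofReal hF hw).1
  · simp_rw [div_eq_mul_inv]
    refine hF.1.neg.mul (Continuous.aestronglyMeasurable ?_)
    exact Continuous.inv₀ (by fun_prop) fun t => pow_ne_zero _ (sub_ofReal_ne_zero hz t)
  · refine .of_forall fun t w hw => ?_
    rw [norm_div, norm_neg, norm_pow, div_eq_mul_inv]
    gcongr
    exact (half_im_lt_im_of_mem_ball hw).le.trans (im_le_norm_sub_ofReal w t)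
  · refine .of_forall fun t w hw => ?_
    have hne := sub_ofReal_ne_zero (hz2.trans (half_im_lt_im_of_mem_ball hw)) t
    have hinv := ((hasDerivAt_id w).sub_const (t : ℂ)).inv hne
    simpa [div_eq_mul_inv, mul_comm] using hinv.const_mul (F t)

theorem inv_ofReal_add_mul_I {y : ℝ} (hy : 0 < y) (u : ℝ) :
    ((u : ℂ) + y * Complex.I)⁻¹ =
      (halfPlaneConjPoisson y u : ℂ) - Complex.I * (halfPlanePoisson y u : ℂ) := by
  have hne : (u : ℂ) ^ 2 + y ^ 2 ≠ 0 := by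
    exact_mod_cast (by positivity : u ^ 2 + y ^ 2 ≠ 0)
  refine inv_eq_of_mul_eq_one_left ?_
  simp only [halfPlanePoisson, halfPlaneConjPoisson]
  push_cast
  field_simp
  linear_combination (-(y : ℂ) ^ 2) * Complex.I_sq

theorem integrable_comp_sub_left_smul {E : Type*} [NormedAddCommGroup E] [NormedSpace ℝ E]
    {F : ℝ → E} (hF : Integrable F) {k : ℝ → ℝ} (hk : Measurable k) {C : ℝ}
    (hle : ∀ u, |k u| ≤ C) (x : ℝ) : Integrable fun t => k (x - t) • F t :=
  hF.bdd_smul C (hk.comp (measurable_const.sub measurable_id)).aestronglyMeasurable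
    (.of_forall fun _ => hle _)

theorem integrable_halfPlanePoisson_smul {E : Type*} [NormedAddCommGroup E] [NormedSpace ℝ E]
    {F : ℝ → E} (hF : Integrable F) (x : ℝ) {y : ℝ} (hy : 0 < y) :
    Integrable fun t => halfPlanePoisson y (x - t) • F t :=
  integrable_comp_sub_left_smul hF (measurable_halfPlanePoisson y)
    (fun u => (abs_of_pos (halfPlanePoisson_pos hy u)).trans_le (halfPlanePoisson_le_inv hy u)) x

theorem integrable_halfPlaneConjPoisson_smul {E : Type*} [NormedAddCommGroup E] [NormedSpace ℝ E]
    {F : ℝ → E} (hF : Integrable F) (x : ℝ) {y : ℝ} (hy : 0 < y) :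
    Integrable fun t => halfPlaneConjPoisson y (x - t) • F t :=
  integrable_comp_sub_left_smul hF (measurable_halfPlaneConjPoisson y)
    (abs_halfPlaneConjPoisson_le_inv hy) x

theorem cauchyTransform_add_mul_I (hF : Integrable F) (x : ℝ) {y : ℝ} (hy : 0 < y) :
    cauchyTransform F (x + y * Complex.I) =
      (∫ t, halfPlaneConjPoisson y (x - t) • F t) -
        Complex.I * ∫ t, halfPlanePoisson y (x - t) • F t := by
  rw [← integral_const_mul, ← integral_sub (integrable_halfPlaneConjPoisson_smul hF x hy)
    ((integrable_halfPlanePoisson_smul hF x hy).const_mul _)]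
  refine integral_congr_ae (.of_forall fun t => ?_)
  have hshift : (x : ℂ) + y * Complex.I - t = ((x - t : ℝ) : ℂ) + y * Complex.I := by
    push_cast
    ring
  simp only [hshift, div_eq_mul_inv, inv_ofReal_add_mul_I hy, Complex.real_smul]
  ring

theorem norm_exp_neg_I_mul_cauchyTransform {f : ℝ → ℝ} (hf : Integrable f) (x : ℝ) {y : ℝ}
    (hy : 0 < y) :
    ‖Complex.exp (-(Complex.I * cauchyTransform (fun t => f t) (x + y * Complex.I)))‖ =
      Real.exp (-∫ t, halfPlanePoisson y (x - t) • f t) := by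
  have hreal : ∀ k : ℝ → ℝ, ∫ t, k (x - t) • (f t : ℂ) = ((∫ t, k (x - t) • f t : ℝ) : ℂ) :=
    fun k => by simp only [← integral_complex_ofReal, smul_eq_mul, Complex.ofReal_mul,
      Complex.real_smul]
  have hdecomp := cauchyTransform_add_mul_I (F := fun t => (f t : ℂ)) hf.ofReal x hy
  rw [Complex.norm_exp, hdecomp, hreal, hreal]
  simp [mul_sub, ← mul_assoc]

theorem continuousOn_comp_add_mul_I {f : ℂ → ℂ} (hf : DifferentiableOn ℂ f {w | 0 < w.im})
    (x : ℝ) : ContinuousOn (fun y : ℝ => f (x + y * Complex.I)) (Ioi 0) :=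
  hf.continuousOn.comp (by fun_prop) fun y hy => by simpa using hy

/-- Here `exp (-i C f)` is bounded by `1`, so it has vertical limits by Fatou's theorem; they are
nonzero because their modulus is the exponential of a limit of Poisson integrals. -/
theorem ae_exists_tendsto_cauchyTransform_of_nonneg {f : ℝ → ℝ} (hf : Integrable f)
    (hnonneg : 0 ≤ f) :
    ∀ᵐ x : ℝ, ∃ l, Tendsto (fun y : ℝ => cauchyTransform (fun t => f t) (x + y * Complex.I))
      (𝓝[>] 0) (𝓝 l) := by
  have hdiff : DifferentiableOn ℂ (fun z => -(Complex.I * cauchyTransform (fun t => f t) z))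
      {w | 0 < w.im} := ((differentiableOn_cauchyTransform hf.ofReal).const_mul _).neg
  have hbound : ∀ w : ℂ, 0 < w.im →
      ‖Complex.exp (-(Complex.I * cauchyTransform (fun t => f t) w))‖ ≤ 1 := fun w hw => by
    have hre := norm_exp_neg_I_mul_cauchyTransform hf w.re hw
    rw [Complex.re_add_im] at hre
    rw [hre, Real.exp_le_one_iff, neg_nonpos]
    exact integral_nonneg fun t => smul_nonneg (halfPlanePoisson_pos hw _).le (hnonneg t)
  filter_upwards [ae_exists_tendsto_add_mul_I_of_bounded hdiff.cexp hbound,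
    ae_isLebesguePoint hf.locallyIntegrable] with x ⟨L, hL⟩ hx
  have hnorm : ‖L‖ = Real.exp (-(Real.pi • f x)) := by
    refine tendsto_nhds_unique hL.norm <| ((Real.continuous_exp.tendsto _).comp
      (hx.tendsto_integral_halfPlanePoisson_smul
        (integrable_halfPlanePoisson_smul hf x one_pos)).neg).congr' ?_
    filter_upwards [self_mem_nhdsWithin] with y hy
    exact (norm_exp_neg_I_mul_cauchyTransform hf x hy).symm
  obtain ⟨l, hl⟩ := exists_tendsto_of_tendsto_exp (continuousOn_comp_add_mul_I hdiff x)
    (norm_pos_iff.1 (hnorm ▸ Real.exp_pos _)) hL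
  refine ⟨Complex.I * l, (hl.const_mul Complex.I).congr fun y => ?_⟩
  rw [mul_neg, ← mul_assoc, Complex.I_mul_I, neg_one_mul, neg_neg]

theorem ae_exists_tendsto_cauchyTransform_add_const_mul (hF : Integrable F) (hG : Integrable G)
    (c : ℂ)
    (hFlim : ∀ᵐ x : ℝ, ∃ l, Tendsto (fun y : ℝ => cauchyTransform F (x + y * Complex.I))
      (𝓝[>] 0) (𝓝 l))
    (hGlim : ∀ᵐ x : ℝ, ∃ l, Tendsto (fun y : ℝ => cauchyTransform G (x + y * Complex.I))
      (𝓝[>] 0) (𝓝 l)) :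
    ∀ᵐ x : ℝ, ∃ l, Tendsto
      (fun y : ℝ => cauchyTransform (fun t => F t + c * G t) (x + y * Complex.I))
      (𝓝[>] 0) (𝓝 l) := by
  filter_upwards [hFlim, hGlim] with x ⟨a, ha⟩ ⟨b, hb⟩
  refine ⟨a + c * b, (ha.add (hb.const_mul c)).congr' ?_⟩
  filter_upwards [self_mem_nhdsWithin] with y hy
  exact (cauchyTransform_add_const_mul hF hG c (by simpa using hy)).symm

theorem ae_exists_tendsto_cauchyTransform_ofReal {f : ℝ → ℝ} (hf : Integrable f) :
    ∀ᵐ x : ℝ, ∃ l, Tendsto (fun y : ℝ => cauchyTransform (fun t => f t) (x + y * Complex.I))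
      (𝓝[>] 0) (𝓝 l) := by
  have hsplit : (fun t => (f t : ℂ)) =
      fun t => ((max (f t) 0 : ℝ) : ℂ) + -1 * ((max (-f t) 0 : ℝ) : ℂ) := by
    ext t
    rw [neg_one_mul, ← sub_eq_add_neg, ← Complex.ofReal_sub, max_zero_sub_eq_self]
  rw [hsplit]
  exact ae_exists_tendsto_cauchyTransform_add_const_mul hf.pos_part.ofReal hf.neg_part.ofReal (-1)
    (ae_exists_tendsto_cauchyTransform_of_nonneg hf.pos_part fun _ => le_max_right _ _)
    (ae_exists_tendsto_cauchyTransform_of_nonneg hf.neg_part fun _ => le_max_right _ _)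

theorem ae_exists_tendsto_cauchyTransform (hF : Integrable F) :
    ∀ᵐ x : ℝ, ∃ l, Tendsto (fun y : ℝ => cauchyTransform F (x + y * Complex.I))
      (𝓝[>] 0) (𝓝 l) := by
  have hsplit : F = fun t => ((F t).re : ℂ) + Complex.I * ((F t).im : ℂ) := by
    ext t
    rw [mul_comm, Complex.re_add_im]
  rw [hsplit]
  exact ae_exists_tendsto_cauchyTransform_add_const_mul hF.re.ofReal hF.im.ofReal Complex.I
    (ae_exists_tendsto_cauchyTransform_ofReal hF.re)
    (ae_exists_tendsto_cauchyTransform_ofReal hF.im)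

end CauchyTransform

section HilbertTransform

/-- The kernel of the truncated Hilbert transform. -/
def truncHilbertKernel (δ u : ℝ) : ℝ := if δ < |u| then u⁻¹ else 0

/-- The conjugate Fejér kernel `∫₀^N (1 - s/N) sin(us) ds` of the `(C,1)` means. -/
def conjFejerKernel (N u : ℝ) : ℝ := ∫ s in (0 : ℝ)..N, (1 - s / N) * Real.sin (u * s)

theorem measurable_truncHilbertKernel (δ : ℝ) : Measurable (truncHilbertKernel δ) :=
  Measurable.ite (measurableSet_lt measurable_const measurable_norm) measurable_inv
    measurable_const

theorem odd_truncHilbertKernel (δ : ℝ) : Function.Odd (truncHilbertKernel δ) := fun u => by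
  simp only [truncHilbertKernel, abs_neg, inv_neg]
  split_ifs <;> simp

theorem abs_truncHilbertKernel_le {δ : ℝ} (hδ : 0 < δ) (u : ℝ) :
    |truncHilbertKernel δ u| ≤ δ⁻¹ := by
  unfold truncHilbertKernel
  split_ifs with h
  · rw [abs_inv]
    exact inv_anti₀ hδ h.le
  · simpa using hδ.le

theorem continuous_conjFejerKernel (N : ℝ) : Continuous (conjFejerKernel N) :=
  intervalIntegral.continuous_parametric_intervalIntegral_of_continuous' (by fun_prop) 0 N

theorem odd_conjFejerKernel (N : ℝ) : Function.Odd (conjFejerKernel N) := fun u => by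
  simp only [conjFejerKernel, neg_mul, Real.sin_neg, mul_neg, intervalIntegral.integral_neg]

theorem abs_conjFejerKernel_le {N : ℝ} (hN : 0 < N) (u : ℝ) : |conjFejerKernel N u| ≤ N := by
  have hbound : ∀ s ∈ uIoc 0 N, ‖(1 - s / N) * Real.sin (u * s)‖ ≤ 1 := fun s hs => by
    rw [uIoc_of_le hN.le] at hs
    have hle : s / N ≤ 1 := (div_le_one hN).2 hs.2
    have hnonneg : 0 ≤ s / N := div_nonneg hs.1.le hN.le
    rw [norm_mul]
    refine mul_le_one₀ ?_ (norm_nonneg _) (Real.abs_sin_le_one _)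
    rw [Real.norm_of_nonneg (sub_nonneg.2 hle)]
    exact sub_le_self _ hnonneg
  simpa [conjFejerKernel, abs_of_pos hN] using
    intervalIntegral.norm_integral_le_of_norm_le_const hbound

theorem conjFejerKernel_eq {N u : ℝ} (hN : 0 < N) (hu : u ≠ 0) :
    conjFejerKernel N u = u⁻¹ - Real.sin (u * N) / (N * u ^ 2) := by
  have hderiv : ∀ s ∈ uIcc 0 N, HasDerivAt
      (fun s => -((1 - s / N) * Real.cos (u * s)) / u - Real.sin (u * s) / (N * u ^ 2))
      ((1 - s / N) * Real.sin (u * s)) s := fun s _ => by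
    have hmul : HasDerivAt (fun s => u * s) u s := by
      simpa using (hasDerivAt_id s).const_mul u
    have hweight : HasDerivAt (fun s => 1 - s / N) (-(1 / N)) s := by
      simpa using ((hasDerivAt_id s).div_const N).const_sub 1
    refine (((hweight.mul hmul.cos).neg.div_const u).sub
      (hmul.sin.div_const (N * u ^ 2))).congr_deriv ?_
    field_simp
    ring
  rw [conjFejerKernel, intervalIntegral.integral_eq_sub_of_hasDerivAt hderiv
    (Continuous.intervalIntegrable (by fun_prop) _ _), div_self hN.ne']
  simp only [sub_self, zero_mul, neg_zero, zero_div, mul_zero, Real.cos_zero, Real.sin_zero,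
    sub_zero]
  field_simp
  ring

theorem abs_conjFejerKernel_sub_truncHilbertKernel_le {y : ℝ} (hy : 0 < y) (u : ℝ) :
    |conjFejerKernel y⁻¹ u - truncHilbertKernel y u| ≤ 2 * halfPlanePoisson y u := by
  unfold truncHilbertKernel
  split_ifs with h
  · have hu : 0 < u ^ 2 := pow_pos (hy.trans h) 2 |>.trans_eq (sq_abs u)
    refine le_trans ?_ (div_sq_le_two_mul_halfPlanePoisson hy h)
    rw [conjFejerKernel_eq (inv_pos.2 hy) (abs_pos.1 (hy.trans h)), sub_sub_cancel_left, abs_neg,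
      abs_div, abs_of_pos (mul_pos (inv_pos.2 hy) hu), div_le_iff₀ (mul_pos (inv_pos.2 hy) hu)]
    calc |Real.sin (u * y⁻¹)| ≤ 1 := Real.abs_sin_le_one _
      _ = y / u ^ 2 * (y⁻¹ * u ^ 2) := by
        rw [div_mul_eq_mul_div, mul_inv_cancel_left₀ hy.ne', div_self hu.ne']
  · rw [sub_zero]
    exact (abs_conjFejerKernel_le (inv_pos.2 hy) u).trans
      (inv_le_two_mul_halfPlanePoisson hy (not_lt.1 h))

theorem abs_truncHilbertKernel_sub_halfPlaneConjPoisson_le {y : ℝ} (hy : 0 < y) (u : ℝ) :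
    |truncHilbertKernel y u - halfPlaneConjPoisson y u| ≤ 2 * halfPlanePoisson y u := by
  have hpos : 0 < u ^ 2 + y ^ 2 := by positivity
  unfold truncHilbertKernel halfPlaneConjPoisson halfPlanePoisson
  split_ifs with h
  · have hu : u ≠ 0 := abs_pos.1 (hy.trans h)
    have hdiff : u⁻¹ - u / (u ^ 2 + y ^ 2) = y ^ 2 / (u * (u ^ 2 + y ^ 2)) := by
      field_simp
      ring
    rw [hdiff, abs_div, abs_mul, abs_of_pos hpos, abs_of_pos (pow_pos hy 2),
      mul_div_assoc', div_le_div_iff₀ (by positivity) hpos]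
    have hle : y ^ 2 ≤ 2 * y * |u| := by nlinarith
    nlinarith
  · rw [zero_sub, abs_neg, abs_div, abs_of_pos hpos, mul_div_assoc']
    gcongr
    linarith [not_lt.1 h]

theorem truncHilbert_eq_integral (F : ℝ → ℂ) (x δ : ℝ) :
    truncHilbert F x δ =
      ((1 / Real.pi : ℝ) : ℂ) * ∫ t, truncHilbertKernel δ (x - t) • F t := by
  have hm : MeasurableSet {t : ℝ | δ < |t - x|} :=
    measurableSet_lt measurable_const (measurable_norm.comp (measurable_id.sub_const x))
  rw [truncHilbert, ← integral_indicator hm]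
  congr 2
  ext t
  simp only [indicator_apply, mem_ofPred_eq, truncHilbertKernel, abs_sub_comm t x, ite_smul,
    zero_smul, Complex.real_smul, Complex.ofReal_inv, div_eq_inv_mul]

variable {F : ℝ → ℂ}

theorem ae_exists_tendsto_integral_halfPlaneConjPoisson_smul (hF : Integrable F) :
    ∀ᵐ x : ℝ, ∃ l, Tendsto (fun y => ∫ t, halfPlaneConjPoisson y (x - t) • F t)
      (𝓝[>] 0) (𝓝 l) := by
  filter_upwards [ae_exists_tendsto_cauchyTransform hF, ae_isLebesguePoint hF.locallyIntegrable]
    with x ⟨a, ha⟩ hx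
  have hPoisson := hx.tendsto_integral_halfPlanePoisson_smul
    (integrable_halfPlanePoisson_smul hF x one_pos)
  refine ⟨_, (ha.add (hPoisson.const_mul Complex.I)).congr' ?_⟩
  filter_upwards [self_mem_nhdsWithin] with y hy
  rw [cauchyTransform_add_mul_I hF x hy, sub_add_cancel]

theorem ae_exists_tendsto_truncHilbert_conjFejer (hF : Integrable F) :
    ∀ᵐ x : ℝ, ∃ l, Tendsto (truncHilbert F x) (𝓝[>] 0) (𝓝 l) ∧
      Tendsto (fun N => ((1 / Real.pi : ℝ) : ℂ) * ∫ t, conjFejerKernel N (x - t) • F t) atTop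
        (𝓝 l) := by
  filter_upwards [ae_exists_tendsto_integral_halfPlaneConjPoisson_smul hF,
    ae_isLebesguePoint hF.locallyIntegrable] with x ⟨a, ha⟩ hx
  have hPoisson := integrable_halfPlanePoisson_smul hF x one_pos
  have htrunc := hx.tendsto_integral_smul_of_odd hPoisson measurable_halfPlaneConjPoisson
    measurable_truncHilbertKernel odd_halfPlaneConjPoisson odd_truncHilbertKernel
    (fun y => abs_truncHilbertKernel_sub_halfPlaneConjPoisson_le)
    (fun y => integrable_halfPlaneConjPoisson_smul hF x) ha
  have hFejer := hx.tendsto_integral_smul_of_odd hPoisson measurable_truncHilbertKernel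
    (fun y => (continuous_conjFejerKernel y⁻¹).measurable) odd_truncHilbertKernel
    (fun y => odd_conjFejerKernel y⁻¹)
    (fun y => abs_conjFejerKernel_sub_truncHilbertKernel_le)
    (fun y hy => integrable_comp_sub_left_smul hF (measurable_truncHilbertKernel y)
      (abs_truncHilbertKernel_le hy) x) htrunc
  refine ⟨_, (htrunc.const_mul ((1 / Real.pi : ℝ) : ℂ)).congr fun δ =>
    (truncHilbert_eq_integral F x δ).symm, ?_⟩
  simpa only [Function.comp_def, inv_inv] using
    (hFejer.comp tendsto_inv_atTop_nhdsGT_zero).const_mul ((1 / Real.pi : ℝ) : ℂ)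

end HilbertTransform

section HalfLine

variable {E : Type*} [NormedAddCommGroup E]

theorem integral_eq_integral_Ioi_add_neg [NormedSpace ℝ E] {h : ℝ → E} (hh : Integrable h) :
    ∫ x, h x = ∫ x in Ioi (0 : ℝ), (h x + h (-x)) := by
  rw [integral_add hh.integrableOn hh.comp_neg.integrableOn, integral_comp_neg_Ioi, neg_zero,
    add_comm, intervalIntegral.integral_Iic_add_Ioi hh.integrableOn hh.integrableOn]

theorem integrable_of_integrableOn_Ioi_of_ae_neg {h : ℝ → ℂ} {c : ℂ}
    (hneg : ∀ᵐ x, h (-x) = c * h x) (hh : IntegrableOn h (Ioi 0)) : Integrable h := by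
  have hreflect : IntegrableOn (fun x => c * h (-x)) (Iio 0) := by
    have hcomp := (MeasurePreserving.integrableOn_comp_preimage
      (Measure.measurePreserving_neg volume) (Homeomorph.neg ℝ).measurableEmbedding).2 hh
    rw [neg_preimage, neg_Ioi, neg_zero] at hcomp
    exact hcomp.const_mul c
  have hIio : IntegrableOn h (Iio 0) := by
    refine hreflect.congr (ae_restrict_of_ae ?_)
    filter_upwards [(Measure.measurePreserving_neg volume).quasiMeasurePreserving.ae hneg] with x hx
    rw [← hx, neg_neg]
  rw [← integrableOn_univ, ← Iic_union_Ioi (a := (0 : ℝ))]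
  exact ((integrableOn_Iic_iff_integrableOn_Iio (by simp)).2 hIio).union hh

theorem TemperedOnHalfLine.locallyIntegrableOn {f : ℝ → ℂ} (hf : TemperedOnHalfLine f) :
    LocallyIntegrableOn f (Ioi 0) := by
  obtain ⟨k, hk⟩ := hf
  have hmul := hk.locallyIntegrableOn.mul_continuousOn (g := fun t : ℝ => (((1 + t) ^ k : ℝ) : ℂ))
    (Continuous.continuousOn (by fun_prop)) isOpen_Ioi.isLocallyClosed
  rw [locallyIntegrableOn_iff isOpen_Ioi.isLocallyClosed] at hmul ⊢
  refine fun K hK hKc => (hmul K hK hKc).congr_fun (fun t ht => ?_) hKc.measurableSet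
  have hpos : 0 < t := hK ht
  exact div_mul_cancel₀ _ (Complex.ofReal_ne_zero.2 (by positivity))

theorem integrable_smul_of_tsupport_subset [NormedSpace ℝ E] {U : Set ℝ} (hU : IsLocallyClosed U)
    {f : ℝ → E} (hf : LocallyIntegrableOn f U) {ρ : ℝ → ℝ} (hρ : Continuous ρ)
    (hρc : HasCompactSupport ρ) (hρU : tsupport ρ ⊆ U) : Integrable fun t => ρ t • f t := by
  have hK := (locallyIntegrableOn_iff hU).1 hf _ hρU hρc
  refine (integrableOn_iff_integrable_of_support_subset ?_).1
    (hK.continuousOn_smul hρ.continuousOn hρc)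
  exact (Function.support_smul_subset_left ρ f).trans (subset_tsupport ρ)

end HalfLine

section CosineSineTransforms

open scoped FourierTransform ContDiff

theorem fourier_comp_mul_inv (h : ℝ → ℂ) {c : ℝ} (hc : 0 < c) (t : ℝ) :
    𝓕 (fun x => h (x * c⁻¹)) (t * c⁻¹) = c * 𝓕 h t := by
  have hscale := Measure.integral_comp_mul_right
    (fun x : ℝ => Complex.exp (↑(-2 * Real.pi * x * t) * Complex.I) • h x) c⁻¹
  rw [inv_inv, abs_of_pos hc, Complex.real_smul] at hscale
  rw [Real.fourier_real_eq_integral_exp_smul, Real.fourier_real_eq_integral_exp_smul, ← hscale]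
  refine integral_congr_ae (.of_forall fun x => ?_)
  simp only [mul_assoc, mul_comm t]

theorem fourier_fourier (η : 𝓢(ℝ, ℂ)) (t : ℝ) : 𝓕 (𝓕 (η : ℝ → ℂ)) t = η (-t) := by
  have hinv : (𝓕⁻ (𝓕 η : 𝓢(ℝ, ℂ)) : 𝓢(ℝ, ℂ)) (-t) = η (-t) := by
    rw [FourierTransform.fourierInv_fourier_eq]
  rwa [SchwartzMap.fourierInv_coe, Real.fourierInv_eq_fourier_neg, neg_neg,
    SchwartzMap.fourier_coe] at hinv

/-- The parity of a function on the line, used to treat the cosine and the sine transform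
simultaneously. -/
inductive Parity
  | even
  | odd

namespace Parity

/-- The sign `c` such that `f (-x) = c * f x` for functions of the given parity. -/
def sign : Parity → ℝ
  | even => 1
  | odd => -1

/-- The kernel of the transform of functions of the given parity. -/
def trig : Parity → ℝ → ℝ
  | even => Real.cos
  | odd => Real.sin

/-- The kernel of the re-expansion, whose parity is opposite to that of `trig`. -/
def conjTrig : Parity → ℝ → ℝ
  | even => Real.sin
  | odd => Real.cos

/-- The unit `u` such that `u * trig θ` is the part of the given parity of `exp (-iθ)`. -/
def unit : Parity → ℂ
  | even => 1
  | odd => -Complex.I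

/-- The extension to the line, with the given parity, of a function on the half-line. -/
def ext : Parity → (ℝ → ℂ) → ℝ → ℂ
  | even => evenExt
  | odd => oddExt

/-- `f` is even or odd, according to the parity. -/
def HasParity (p : Parity) (f : ℝ → ℂ) : Prop := ∀ x, f (-x) = p.sign * f x

/-- The cosine or sine transform of a function on the half-line, as an ordinary integral. -/
def transform (p : Parity) (g : ℝ → ℂ) (t : ℝ) : ℂ :=
  ∫ x in Ioi (0 : ℝ), g x * (p.trig (t * x) : ℂ)

/-- `g` is the cosine or sine transform of `f` in the sense of distributions; the growth conditions
are not part of the definition. -/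
def IsTransform (p : Parity) (f g : ℝ → ℂ) : Prop :=
  ∀ φ : 𝓢(ℝ, ℂ), p.HasParity φ →
    ∫ t in Ioi (0 : ℝ), f t * p.transform φ t = ∫ x in Ioi (0 : ℝ), g x * φ x

variable (p : Parity) {f g h : ℝ → ℂ}

theorem sign_mul_self : (p.sign : ℂ) * p.sign = 1 := by
  cases p <;> simp [sign]

theorem unit_mul_self : p.unit * p.unit = p.sign := by
  cases p <;> simp [sign, unit]

theorem unit_ne_zero : p.unit ≠ 0 := by
  cases p <;> simp [unit]

theorem continuous_trig : Continuous p.trig := by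
  cases p
  exacts [Real.continuous_cos, Real.continuous_sin]

theorem continuous_conjTrig : Continuous p.conjTrig := by
  cases p
  exacts [Real.continuous_sin, Real.continuous_cos]

theorem abs_trig_le_one (θ : ℝ) : |p.trig θ| ≤ 1 := by
  cases p
  exacts [Real.abs_cos_le_one θ, Real.abs_sin_le_one θ]

theorem trig_neg (θ : ℝ) : p.trig (-θ) = p.sign * p.trig θ := by
  cases p <;> simp [sign, trig]

theorem trig_mul_conjTrig (a b : ℝ) :
    p.trig a * p.conjTrig b = (Real.sin (b + a) + p.sign * Real.sin (b - a)) / 2 := by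
  rw [Real.sin_add, Real.sin_sub]
  cases p <;> simp only [sign, trig, conjTrig] <;> ring

theorem exp_neg_add_sign_mul_exp (θ : ℝ) :
    Complex.exp (-(θ * Complex.I)) + p.sign * Complex.exp (θ * Complex.I) =
      2 * p.unit * p.trig θ := by
  cases p
  · simp only [sign, unit, trig, Complex.ofReal_cos, Complex.ofReal_one, Complex.cos, neg_mul]
    ring
  · simp only [sign, unit, trig, Complex.ofReal_sin, Complex.ofReal_neg, Complex.ofReal_one,
      Complex.sin, neg_mul]
    linear_combination
      (Complex.exp (-(θ * Complex.I)) - Complex.exp (θ * Complex.I)) * Complex.I_sq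

theorem hasParity_ext (g : ℝ → ℂ) : p.HasParity (p.ext g) := by
  intro x
  cases p <;> simp [ext, sign, evenExt, oddExt, Real.sign_neg]

theorem ext_of_pos (g : ℝ → ℂ) {x : ℝ} (hx : 0 < x) : p.ext g x = g x := by
  cases p <;> simp [ext, evenExt, oddExt, abs_of_pos hx, Real.sign_of_pos hx]

theorem integrable_ext (hg : IntegrableOn g (Ioi 0)) : Integrable (p.ext g) :=
  integrable_of_integrableOn_Ioi_of_ae_neg (.of_forall (p.hasParity_ext g))
    (hg.congr_fun (fun _ hx => (p.ext_of_pos g hx).symm) measurableSet_Ioi)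

theorem hasParity_transform (g : ℝ → ℂ) : p.HasParity (p.transform g) := fun t => by
  simp only [transform, neg_mul, p.trig_neg, Complex.ofReal_mul, ← integral_const_mul,
    mul_left_comm]

theorem continuous_transform (hg : IntegrableOn g (Ioi 0)) : Continuous (p.transform g) := by
  have hcont := p.continuous_trig
  refine continuous_of_dominated (bound := fun x => ‖g x‖) (fun t => ?_)
    (fun t => .of_forall fun x => ?_) hg.norm (.of_forall fun x => by fun_prop)
  · exact hg.1.mul (Continuous.aestronglyMeasurable (by fun_prop))
  · rw [norm_mul, Complex.norm_real]
    exact mul_le_of_le_one_right (norm_nonneg _) (p.abs_trig_le_one _)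

theorem integral_mul_transform (hg : IntegrableOn g (Ioi 0)) (hh : IntegrableOn h (Ioi 0)) :
    ∫ x in Ioi (0 : ℝ), g x * p.transform h x = ∫ t in Ioi (0 : ℝ), p.transform g t * h t := by
  have hcont := p.continuous_trig
  have hint : Integrable (fun q : ℝ × ℝ => g q.1 * h q.2 * (p.trig (q.1 * q.2) : ℂ))
      ((volume.restrict (Ioi 0)).prod (volume.restrict (Ioi 0))) :=
    (hg.mul_prod hh).mul_bdd (c := 1) (Continuous.aestronglyMeasurable (by fun_prop))
      (.of_forall fun q => (Complex.norm_real _).trans_le (p.abs_trig_le_one _))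
  simp only [transform, ← integral_const_mul, ← integral_mul_const]
  simp only [← mul_assoc]
  rw [integral_integral_swap hint]
  refine integral_congr_ae (.of_forall fun t => integral_congr_ae (.of_forall fun x => ?_))
  simp only [mul_comm t x]
  ring

variable {p}

theorem HasParity.integral_mul_exp (hpar : p.HasParity h) (hh : Integrable h) (t : ℝ) :
    ∫ x : ℝ, h x * Complex.exp (-((t * x : ℝ) * Complex.I)) = 2 * p.unit * p.transform h t := by
  have hint : Integrable fun x : ℝ => h x * Complex.exp (-((t * x : ℝ) * Complex.I)) := by
    refine hh.mul_bdd (c := 1) (Continuous.aestronglyMeasurable (by fun_prop))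
      (.of_forall fun x => ?_)
    rw [← neg_mul, ← Complex.ofReal_neg, Complex.norm_exp_ofReal_mul_I]
  rw [integral_eq_integral_Ioi_add_neg hint, transform, ← integral_const_mul]
  refine integral_congr_ae (.of_forall fun x => ?_)
  simp only
  rw [hpar, mul_neg, Complex.ofReal_neg, neg_mul, neg_neg]
  linear_combination h x * p.exp_neg_add_sign_mul_exp (t * x)

theorem HasParity.fourier_eq_transform (hpar : p.HasParity h) (hh : Integrable h) (t : ℝ) :
    𝓕 h (t * (2 * Real.pi)⁻¹) = 2 * p.unit * p.transform h t := by
  rw [← hpar.integral_mul_exp hh, Real.fourier_real_eq_integral_exp_smul]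
  refine integral_congr_ae (.of_forall fun x => ?_)
  simp only
  rw [smul_eq_mul, mul_comm, ← neg_mul, ← Complex.ofReal_neg]
  congr 4
  field_simp

theorem HasParity.exists_schwartzMap_eq_transform {η : 𝓢(ℝ, ℂ)} (hη : p.HasParity η) :
    ∃ φ : 𝓢(ℝ, ℂ), ⇑φ = p.transform η := by
  have hscale : (2 * Real.pi)⁻¹ ≠ 0 := by positivity
  refine ⟨(2 * p.unit)⁻¹ • SchwartzMap.compCLMOfContinuousLinearEquiv ℂ
    (ContinuousLinearEquiv.unitsEquivAut ℝ (Units.mk0 _ hscale)) (𝓕 η), funext fun t => ?_⟩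
  change (2 * p.unit)⁻¹ * 𝓕 (η : ℝ → ℂ) (t * (2 * Real.pi)⁻¹) = _
  rw [hη.fourier_eq_transform η.integrable,
    inv_mul_cancel_left₀ (mul_ne_zero two_ne_zero p.unit_ne_zero)]

theorem HasParity.transform_transform {η : 𝓢(ℝ, ℂ)} (hη : p.HasParity η) (t : ℝ) :
    p.transform (p.transform η) t = (Real.pi / 2 : ℂ) * η t := by
  obtain ⟨φ, hφ⟩ := hη.exists_schwartzMap_eq_transform
  have hu := p.unit_ne_zero
  have hinner : p.transform η = fun x => (2 * p.unit)⁻¹ * 𝓕 (η : ℝ → ℂ) (x * (2 * Real.pi)⁻¹) := by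
    ext x
    rw [hη.fourier_eq_transform η.integrable,
      inv_mul_cancel_left₀ (mul_ne_zero two_ne_zero hu)]
  have houter := (p.hasParity_transform η).fourier_eq_transform (hφ ▸ φ.integrable) t
  have hdouble : 𝓕 (p.transform η) (t * (2 * Real.pi)⁻¹) =
      (2 * p.unit)⁻¹ * ((2 * Real.pi : ℝ) * (p.sign * η t)) := by
    rw [hinner, ← hη t, ← fourier_fourier η t, ← fourier_comp_mul_inv _ Real.two_pi_pos,
      Real.fourier_real_eq_integral_exp_smul, Real.fourier_real_eq_integral_exp_smul,
      ← integral_const_mul]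
    exact integral_congr_ae (.of_forall fun x => mul_left_comm _ _ _)
  rw [hdouble, ← p.unit_mul_self] at houter
  refine mul_left_cancel₀ (mul_ne_zero two_ne_zero hu) ?_
  rw [← houter]
  push_cast
  field_simp

variable (p) in
theorem exists_schwartzMap_hasParity_eqOn {ρ : ℝ → ℝ} (hρ : ContDiff ℝ ∞ ρ)
    (hρc : HasCompactSupport ρ) (hρU : tsupport ρ ⊆ Ioi 0) :
    ∃ η : 𝓢(ℝ, ℂ), p.HasParity η ∧ EqOn η (fun t => (ρ t : ℂ)) (Ioi 0) := by
  have hsupp : HasCompactSupport fun x => (ρ x : ℂ) + p.sign * (ρ (-x) : ℂ) :=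
    (hρc.comp_left Complex.ofReal_zero).add (HasCompactSupport.mul_left
      ((hρc.comp_homeomorph (Homeomorph.neg ℝ)).comp_left Complex.ofReal_zero))
  have hsmooth : ContDiff ℝ ∞ fun x => (ρ x : ℂ) + p.sign * (ρ (-x) : ℂ) := by
    have hofReal : ContDiff ℝ ∞ fun x => (ρ x : ℂ) := Complex.ofRealCLM.contDiff.comp hρ
    exact hofReal.add (contDiff_const.mul (hofReal.comp contDiff_neg))
  refine ⟨hsupp.toSchwartzMap hsmooth, fun x => ?_, fun t ht => ?_⟩
  · change (ρ (-x) : ℂ) + p.sign * (ρ (- -x) : ℂ) = p.sign * (ρ x + p.sign * (ρ (-x) : ℂ))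
    rw [neg_neg]
    linear_combination (-(ρ (-x) : ℂ)) * p.sign_mul_self
  · have hzero : ρ (-t) = 0 := image_eq_zero_of_notMem_tsupport fun hmem =>
      (neg_neg_of_pos (mem_Ioi.1 ht)).not_gt (hρU hmem)
    change (ρ t : ℂ) + p.sign * (ρ (-t) : ℂ) = ρ t
    rw [hzero, Complex.ofReal_zero, mul_zero, add_zero]

theorem IsTransform.integral_mul_eq (hfg : p.IsTransform f g) (hg : IntegrableOn g (Ioi 0))
    {η : 𝓢(ℝ, ℂ)} (hη : p.HasParity η) :
    ∫ t in Ioi (0 : ℝ), f t * η t =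
      ∫ t in Ioi (0 : ℝ), (2 / Real.pi : ℂ) * p.transform g t * η t := by
  obtain ⟨φ, hφ⟩ := hη.exists_schwartzMap_eq_transform
  have hφpar : p.HasParity φ := hφ ▸ p.hasParity_transform η
  have htest := hfg φ hφpar
  simp only [hφ, hη.transform_transform] at htest
  rw [p.integral_mul_transform hg η.integrable.integrableOn] at htest
  have hpi : (Real.pi : ℂ) ≠ 0 := Complex.ofReal_ne_zero.2 Real.pi_ne_zero
  simp only [mul_assoc]
  rw [integral_const_mul, ← htest, ← integral_const_mul]
  refine integral_congr_ae (.of_forall fun t => ?_)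
  simp only
  field_simp

theorem IsTransform.ae_eq_transform (hfg : p.IsTransform f g)
    (hf : LocallyIntegrableOn f (Ioi 0)) (hg : IntegrableOn g (Ioi 0)) :
    ∀ᵐ t, t ∈ Ioi (0 : ℝ) → f t = (2 / Real.pi : ℂ) * p.transform g t := by
  have hT : LocallyIntegrableOn (fun t => (2 / Real.pi : ℂ) * p.transform g t) (Ioi 0) :=
    (continuous_const.mul (p.continuous_transform hg)).locallyIntegrable.locallyIntegrableOn _
  suffices hweak : ∀ ρ : ℝ → ℝ, ContDiff ℝ ∞ ρ → HasCompactSupport ρ → tsupport ρ ⊆ Ioi 0 →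
      ∫ t, ρ t • (f t - (2 / Real.pi : ℂ) * p.transform g t) = 0 by
    filter_upwards [isOpen_Ioi.ae_eq_zero_of_integral_contDiff_smul_eq_zero (hf.sub hT) hweak]
      with t ht hpos
    exact sub_eq_zero.1 (ht hpos)
  intro ρ hρ hρc hρU
  obtain ⟨η, hη, hηρ⟩ := p.exists_schwartzMap_hasParity_eqOn hρ hρc hρU
  have hset (u : ℝ → ℂ) : ∫ t, ρ t • u t = ∫ t in Ioi (0 : ℝ), u t * η t := by
    rw [← setIntegral_eq_integral_of_forall_compl_eq_zero (s := Ioi (0 : ℝ)) fun t ht => by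
      rw [image_eq_zero_of_notMem_tsupport fun hmem => ht (hρU hmem), zero_smul]]
    refine setIntegral_congr_fun measurableSet_Ioi fun t ht => ?_
    simp only [hηρ ht, Complex.real_smul, mul_comm]
  have hint {u : ℝ → ℂ} (hu : LocallyIntegrableOn u (Ioi 0)) : Integrable fun t => ρ t • u t :=
    integrable_smul_of_tsupport_subset isOpen_Ioi.isLocallyClosed hu hρ.continuous hρc hρU
  simp only [smul_sub]
  rw [integral_sub (hint hf) (hint hT), hset, hset, hfg.integral_mul_eq hg hη, sub_self]

end Parity

end CosineSineTransforms

section Reexpansion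

namespace Parity

/-- The `(C,1)` means of the re-expansion with respect to the conjugate kernel. -/
def mean (p : Parity) (f : ℝ → ℂ) (x N : ℝ) : ℂ :=
  ∫ t in (0 : ℝ)..N, ((1 - t / N : ℝ) : ℂ) * f t * (p.conjTrig (x * t) : ℂ)

/-- The re-expansion with respect to the conjugate kernel, as a `(C,1)` limit. -/
def reexpansion (p : Parity) (f : ℝ → ℂ) (x : ℝ) : ℂ := limUnder atTop (p.mean f x)

/-- The weight on the half-line whose pairing with `f` is the `(C,1)` mean of `f`. -/
def meanWeight (p : Parity) (x N : ℝ) : ℝ → ℂ :=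
  (Ioc 0 N).indicator fun t => (((1 - t / N) * p.conjTrig (x * t) : ℝ) : ℂ)

variable (p : Parity) {f g F : ℝ → ℂ}

theorem setIntegral_mul_meanWeight (u : ℝ → ℂ) (x N : ℝ) :
    ∫ t in Ioi (0 : ℝ), u t * p.meanWeight x N t =
      ∫ t in Ioc 0 N, u t * (((1 - t / N) * p.conjTrig (x * t) : ℝ) : ℂ) := by
  simp only [meanWeight, ← indicator_mul_right]
  rw [setIntegral_indicator measurableSet_Ioc, inter_eq_right.2 Ioc_subset_Ioi_self]

theorem mean_eq_integral_mul_meanWeight (f : ℝ → ℂ) (x : ℝ) {N : ℝ} (hN : 0 ≤ N) :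
    p.mean f x N = ∫ t in Ioi (0 : ℝ), f t * p.meanWeight x N t := by
  rw [setIntegral_mul_meanWeight, mean, intervalIntegral.integral_of_le hN]
  refine integral_congr_ae (.of_forall fun t => ?_)
  simp only
  push_cast
  ring

theorem integrable_meanWeight (x N : ℝ) : Integrable (p.meanWeight x N) := by
  have hcont := p.continuous_conjTrig
  rw [meanWeight, integrable_indicator_iff measurableSet_Ioc]
  exact (Continuous.integrableOn_Icc (by fun_prop)).mono_set Ioc_subset_Icc_self

theorem transform_meanWeight (x y : ℝ) {N : ℝ} (hN : 0 ≤ N) :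
    p.transform (p.meanWeight x N) y =
      (conjFejerKernel N (x + y) + p.sign * conjFejerKernel N (x - y)) / 2 := by
  have hreal : ∫ t in (0 : ℝ)..N, (1 - t / N) * (p.trig (y * t) * p.conjTrig (x * t)) =
      (conjFejerKernel N (x + y) + p.sign * conjFejerKernel N (x - y)) / 2 := by
    simp only [conjFejerKernel]
    rw [← intervalIntegral.integral_const_mul, ← intervalIntegral.integral_add
      (Continuous.intervalIntegrable (by fun_prop) _ _)
      (Continuous.intervalIntegrable (by fun_prop) _ _), ← intervalIntegral.integral_div]
    refine intervalIntegral.integral_congr fun t _ => ?_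
    rw [trig_mul_conjTrig, ← add_mul, ← sub_mul]
    ring
  have hcomplex := congrArg Complex.ofReal hreal
  rw [intervalIntegral.integral_of_le hN, ← integral_complex_ofReal] at hcomplex
  push_cast at hcomplex
  simp only [transform, mul_comm (p.meanWeight x N _)]
  rw [setIntegral_mul_meanWeight, ← hcomplex]
  refine integral_congr_ae (.of_forall fun t => ?_)
  simp only
  push_cast
  ring

variable {p}

theorem IsTransform.mean_eq (hfg : p.IsTransform f g) (hf : LocallyIntegrableOn f (Ioi 0))
    (hg : IntegrableOn g (Ioi 0)) (x : ℝ) {N : ℝ} (hN : 0 < N) :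
    p.mean f x N =
      p.sign * (((1 / Real.pi : ℝ) : ℂ) * ∫ t, conjFejerKernel N (x - t) • p.ext g t) := by
  have hint : Integrable fun t => conjFejerKernel N (x - t) • p.ext g t :=
    integrable_comp_sub_left_smul (p.integrable_ext hg) (continuous_conjFejerKernel N).measurable
      (abs_conjFejerKernel_le hN) x
  have hfold (y : ℝ) (hy : y ∈ Ioi (0 : ℝ)) :
      (2 / Real.pi : ℂ) * (g y * p.transform (p.meanWeight x N) y) =
        p.sign * ((1 / Real.pi : ℝ) : ℂ) * (conjFejerKernel N (x - y) • p.ext g y +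
          conjFejerKernel N (x - -y) • p.ext g (-y)) := by
    rw [p.transform_meanWeight x y hN.le, p.hasParity_ext g, p.ext_of_pos g hy, sub_neg_eq_add]
    simp only [Complex.real_smul]
    push_cast
    linear_combination
      (-(1 / Real.pi * g y * conjFejerKernel N (x + y)) : ℂ) * p.sign_mul_self
  calc p.mean f x N
      = ∫ t in Ioi (0 : ℝ), (2 / Real.pi : ℂ) * (p.transform g t * p.meanWeight x N t) := by
        rw [p.mean_eq_integral_mul_meanWeight f x hN.le]
        refine setIntegral_congr_ae measurableSet_Ioi ?_
        filter_upwards [hfg.ae_eq_transform hf hg] with t ht hpos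
        rw [ht hpos, mul_assoc]
    _ = ∫ y in Ioi (0 : ℝ), (2 / Real.pi : ℂ) * (g y * p.transform (p.meanWeight x N) y) := by
        rw [integral_const_mul, integral_const_mul,
          ← p.integral_mul_transform hg (p.integrable_meanWeight x N).integrableOn]
    _ = _ := by
        rw [setIntegral_congr_fun measurableSet_Ioi hfold, integral_const_mul,
          ← integral_eq_integral_Ioi_add_neg hint, mul_assoc]

theorem HasParity.truncHilbert_neg (hF : p.HasParity F) (x δ : ℝ) :
    truncHilbert F (-x) δ = -p.sign * truncHilbert F x δ := by
  rw [truncHilbert_eq_integral, truncHilbert_eq_integral, mul_left_comm]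
  congr 1
  rw [← integral_neg_eq_self, ← integral_const_mul]
  refine integral_congr_ae (.of_forall fun t => ?_)
  simp only
  rw [hF, neg_sub_neg, ← neg_sub x t, odd_truncHilbertKernel]
  simp only [Complex.real_smul]
  push_cast
  ring

theorem HasParity.ae_hilbertTransform_neg (hF : p.HasParity F) (hFint : Integrable F) :
    ∀ᵐ x, hilbertTransform F (-x) = -p.sign * hilbertTransform F x := by
  filter_upwards [ae_exists_tendsto_truncHilbert_conjFejer hFint] with x ⟨l, hl, _⟩
  rw [show hilbertTransform F x = l from hl.limUnder_eq]
  exact ((hl.const_mul (-p.sign : ℂ)).congr fun δ => (hF.truncHilbert_neg x δ).symm).limUnder_eq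

theorem IsTransform.ae_tendsto_mean (hfg : p.IsTransform f g)
    (hf : LocallyIntegrableOn f (Ioi 0)) (hg : IntegrableOn g (Ioi 0)) :
    ∀ᵐ x, Tendsto (p.mean f x) atTop (𝓝 (p.sign * hilbertTransform (p.ext g) x)) := by
  filter_upwards [ae_exists_tendsto_truncHilbert_conjFejer (p.integrable_ext hg)]
    with x ⟨l, hl, hconj⟩
  rw [show hilbertTransform (p.ext g) x = l from hl.limUnder_eq]
  refine (hconj.const_mul (p.sign : ℂ)).congr' ?_
  filter_upwards [eventually_gt_atTop 0] with N hN
  rw [hfg.mean_eq hf hg x hN]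

theorem IsTransform.ae_reexpansion_eq (hfg : p.IsTransform f g)
    (hf : LocallyIntegrableOn f (Ioi 0)) (hg : IntegrableOn g (Ioi 0)) :
    ∀ᵐ x, p.reexpansion f x = p.sign * hilbertTransform (p.ext g) x :=
  (hfg.ae_tendsto_mean hf hg).mono fun _ hx => hx.limUnder_eq

theorem IsTransform.ae_tendsto_reexpansion (hfg : p.IsTransform f g)
    (hf : LocallyIntegrableOn f (Ioi 0)) (hg : IntegrableOn g (Ioi 0)) :
    ∀ᵐ x, Tendsto (p.mean f x) atTop (𝓝 (p.reexpansion f x)) :=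
  (hfg.ae_tendsto_mean hf hg).mono fun _ hx => tendsto_nhds_limUnder ⟨_, hx⟩

theorem IsTransform.integrableOn_reexpansion_iff (hfg : p.IsTransform f g)
    (hf : LocallyIntegrableOn f (Ioi 0)) (hg : IntegrableOn g (Ioi 0)) :
    IntegrableOn (p.reexpansion f) (Ioi 0) ↔ Integrable (hilbertTransform (p.ext g)) := by
  have hsign : IsUnit (p.sign : ℂ) := IsUnit.of_mul_eq_one _ p.sign_mul_self
  have heq := ae_restrict_of_ae (s := Ioi (0 : ℝ)) (hfg.ae_reexpansion_eq hf hg)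
  rw [IntegrableOn, integrable_congr heq, integrable_const_mul_iff hsign]
  exact ⟨integrable_of_integrableOn_Ioi_of_ae_neg
    ((p.hasParity_ext g).ae_hilbertTransform_neg (p.integrable_ext hg)), Integrable.integrableOn⟩

end Parity

theorem ae_tendsto_truncHilbert {F : ℝ → ℂ} (hF : Integrable F) :
    ∀ᵐ x, Tendsto (truncHilbert F x) (𝓝[>] 0) (𝓝 (hilbertTransform F x)) :=
  (ae_exists_tendsto_truncHilbert_conjFejer hF).mono fun _ ⟨l, hl, _⟩ =>
    tendsto_nhds_limUnder ⟨l, hl⟩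

theorem IsCosineTransform.isTransform {f g : ℝ → ℂ} (h : IsCosineTransform f g) :
    Parity.even.IsTransform f g := fun φ hφ =>
  h.2.2 φ fun x => by simpa [Parity.sign] using hφ x

theorem IsSineTransform.isTransform {f g : ℝ → ℂ} (h : IsSineTransform f g) :
    Parity.odd.IsTransform f g := fun φ hφ =>
  h.2.2 φ fun x => by simpa [Parity.sign] using hφ x

end Reexpansion

end

theorem theorem1 :
    (∀ f Fc : ℝ → ℂ, IsCosineTransform f Fc → IntegrableOn Fc (Ioi 0) →
      (∀ᵐ x : ℝ, Tendsto (sineMean f x) atTop (𝓝 (sineReexpansion f x))) ∧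
      (∀ᵐ x : ℝ, Tendsto (truncHilbert (evenExt Fc) x) (𝓝[>] 0)
        (𝓝 (hilbertTransform (evenExt Fc) x))) ∧
      (∀ᵐ x : ℝ, sineReexpansion f x = hilbertTransform (evenExt Fc) x) ∧
      (IntegrableOn (sineReexpansion f) (Ioi 0) ↔
        Integrable (hilbertTransform (evenExt Fc)))) ∧
    (∀ f Fs : ℝ → ℂ, IsSineTransform f Fs → IntegrableOn Fs (Ioi 0) →
      (∀ᵐ x : ℝ, Tendsto (cosineMean f x) atTop (𝓝 (cosineReexpansion f x))) ∧
      (∀ᵐ x : ℝ, Tendsto (truncHilbert (oddExt Fs) x) (𝓝[>] 0)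
        (𝓝 (hilbertTransform (oddExt Fs) x))) ∧
      (∀ᵐ x : ℝ, cosineReexpansion f x = -hilbertTransform (oddExt Fs) x) ∧
      (IntegrableOn (cosineReexpansion f) (Ioi 0) ↔
        Integrable (hilbertTransform (oddExt Fs)))) := by
  refine ⟨fun f Fc h hFc => ?_, fun f Fs h hFs => ?_⟩
  · have hf := h.1.locallyIntegrableOn
    refine ⟨h.isTransform.ae_tendsto_reexpansion hf hFc,
      ae_tendsto_truncHilbert (Parity.even.integrable_ext hFc), ?_,
      h.isTransform.integrableOn_reexpansion_iff hf hFc⟩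
    filter_upwards [h.isTransform.ae_reexpansion_eq hf hFc] with x hx
    exact hx.trans (by rw [Parity.sign, Complex.ofReal_one, one_mul, Parity.ext])
  · have hf := h.1.locallyIntegrableOn
    refine ⟨h.isTransform.ae_tendsto_reexpansion hf hFs,
      ae_tendsto_truncHilbert (Parity.odd.integrable_ext hFs), ?_,
      h.isTransform.integrableOn_reexpansion_iff hf hFs⟩
    filter_upwards [h.isTransform.ae_reexpansion_eq hf hFs] with x hx
    exact hx.trans (by
      rw [Parity.sign, Complex.ofReal_neg, Complex.ofReal_one, neg_one_mul, Parity.ext])
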